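/- For a random vector $\eta$ in $\mathbb R^d$ whose law has a density $\rho$ with respect to the Lebesgue measure, let \[ S(\eta) = -\int_{\mathbb R^d} \rho\log\rho \, dx = \int_{\mathbb R^d} (-\rho\log\rho)^+ \, dx - \int_{\mathbb R^d} (-\rho\log\rho)^- \, dx \in [-\infty,+\infty] \] be its Shannon (differential) entropy, and let $S(\eta) = -\infty$ if the law of $\eta$ is not absolutely continuous. The conventions $\infty-\infty=-\infty$ and $0\cdot(\pm\infty)=0$ are used. Theorem (Shannon's inequality). Let $\eta,\xi$ be independent random vectors in $\mathbb R^d$, defined on the same probability space, and let $\theta\in[0,\pi/2]$. Then \[ S(\cos(\theta)\,\eta+\sin(\theta)\,\xi) \ \ge\ \cos(\theta)^2\, S(\eta)+\sin(\theta)^2\, S(\xi) . \] Moreover, if $\eta$ and $\xi$ both have densities, then so does $\cos(\theta)\,\eta+\sin(\theta)\,\xi$. -/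

import Mathlib

open MeasureTheory ProbabilityTheory

/-- The density of `μ` with respect to the Lebesgue measure of `ℝ^d`. It is only used
when `μ` is absolutely continuous. -/
noncomputable def lebesgueDensity {d : ℕ} (μ : Measure (EuclideanSpace ℝ (Fin d))) :
    EuclideanSpace ℝ (Fin d) → ℝ :=
  fun x => (μ.rnDeriv volume x).toReal

open Classical in
/-- Shannon (differential) entropy `-∫ ρ log ρ dx` of a law `μ` on `ℝ^d` with density `ρ`, as
an extended real number: the integral of the positive part of `-ρ log ρ` minus the integral
of its negative part. The value is `-∞` if `μ` has no density (the relative entropy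
with respect to the Lebesgue measure is then `+∞`), and, since `⊤ - ⊤ = ⊥` in `EReal`, also if both
parts have infinite integral. -/
noncomputable def shannonEntropy {d : ℕ} (μ : Measure (EuclideanSpace ℝ (Fin d))) : EReal :=
  if μ ≪ volume then
    ((∫⁻ x, ENNReal.ofReal (-(lebesgueDensity μ x * Real.log (lebesgueDensity μ x))) : ENNReal)
        : EReal)
      - ((∫⁻ x, ENNReal.ofReal (lebesgueDensity μ x * Real.log (lebesgueDensity μ x)) : ENNReal)
        : EReal)
  else ⊥

/-! Put `c = cos θ`, `s = sin θ`. The theorem follows from an inequality in the style of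
Prékopa–Leindler with a free test function `q`: if `f`, `g`, `q` have masses `a`, `b`, `m`, then `∫∫
f(x) g(y) [log q(cx+sy) - c² log f(x) - s² log g(y)] ≤ a b (log m - c² log a - s² log b)`. For
probability densities `f`, `g` and for `q` the density of the combination, the right side is `0`,
and the first term on the left is minus the entropy of the combination.

On the line (`integral_entropyKernel_le_log`), probability densities `f`, `g` are images of the
standard Gaussian `γ` under monotone maps `T`, `U`, with `f(T) T' = γ` almost everywhere. Concavity
of `log` gives `c² log T' + s² log U' ≤ log (c² T' + s² U')`. With `cy - sx` fixed, `cT(x) + sU(y)`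
is a monotone function of `cx + sy` with derivative `c² T' + s² U'`. Hence `q(cT+sU) (c² T' + s² U')
/ γ(cx+sy)` has Gaussian mean at most `m` (`lintegral_rotated_combination_le`), and `log u ≤ u - 1`
turns this into the claim. The Gaussian exponents leave only `-c s x y`, which has mean zero.

Both sides of the inequality have the same shape, so using it on slices and then on marginals
carries it to products (`EntropyIneq.prod`), hence to all dimensions. The freedom in `q` makes this
possible: slices of the density of a sum need not be densities of sums of slices.

Bounded densities with bounded support then satisfy the entropy inequality
(`EntropyIneq.entropyBound`). General ones are truncated, and the limit (`entropy_combDensity_ge`)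
uses dominated convergence for the positive part of the entropy and Fatou for the negative part. A
Jensen bound (`entropyNegPart_combDensity_lt_top`) excludes `∞ - ∞` for the combination. -/

/-! ### Monotone transport of the Gaussian law on the line -/

section Transport

open Set Filter Topology

/-- The distribution function of a density on the line. -/
noncomputable def distribFun (f : ℝ → ℝ) (t : ℝ) : ℝ := ∫ u in Iic t, f u

theorem distribFun_eq_add {f : ℝ → ℝ} (hf : Integrable f) (a t : ℝ) :
    distribFun f t = distribFun f a + ∫ u in a..t, f u := by
  rw [distribFun, distribFun,
    ← intervalIntegral.integral_Iic_sub_Iic hf.integrableOn hf.integrableOn]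
  ring

theorem ae_hasDerivAt_distribFun {f : ℝ → ℝ} (hf : Integrable f) :
    ∀ᵐ x, HasDerivAt (distribFun f) (f x) x := by
  filter_upwards [_root_.LocallyIntegrable.ae_hasDerivAt_integral hf.locallyIntegrable] with x hx
  have := (hx 0).const_add (distribFun f 0)
  convert! this using 1
  funext t
  exact distribFun_eq_add hf 0 t

theorem hasDerivAt_distribFun_of_continuous {f : ℝ → ℝ} (hf : Integrable f) (hc : Continuous f)
    (x : ℝ) : HasDerivAt (distribFun f) (f x) x := by
  have := (hc.integral_hasStrictDerivAt 0 x).hasDerivAt.const_add (distribFun f 0)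
  convert! this using 1
  funext t
  exact distribFun_eq_add hf 0 t

theorem continuous_distribFun {f : ℝ → ℝ} (hf : Integrable f) : Continuous (distribFun f) := by
  have : distribFun f = fun t => distribFun f 0 + ∫ u in (0 : ℝ)..t, f u :=
    funext fun t => distribFun_eq_add hf 0 t
  rw [this]
  exact continuous_const.add (intervalIntegral.continuous_primitive
    (fun _ _ => hf.intervalIntegrable) 0)

theorem monotone_distribFun {f : ℝ → ℝ} (hf : Integrable f) (h0 : ∀ x, 0 ≤ f x) :
    Monotone (distribFun f) := fun _ _ hab =>
  setIntegral_mono_set hf.integrableOn (Eventually.of_forall h0)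
    (Iic_subset_Iic.2 hab).eventuallyLE

theorem ofReal_distribFun {f : ℝ → ℝ} (hf : Integrable f) (h0 : ∀ x, 0 ≤ f x) (t : ℝ) :
    volume.withDensity (fun x => ENNReal.ofReal (f x)) (Iic t)
      = ENNReal.ofReal (distribFun f t) := by
  rw [withDensity_apply _ measurableSet_Iic, distribFun,
    ofReal_integral_eq_lintegral_ofReal hf.integrableOn (Eventually.of_forall h0)]

theorem isProbabilityMeasure_withDensity_ofReal {f : ℝ → ℝ} (hf : Integrable f)
    (h0 : ∀ x, 0 ≤ f x) (h1 : ∫ x, f x = 1) :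
    IsProbabilityMeasure (volume.withDensity fun x => ENNReal.ofReal (f x)) := by
  constructor
  rw [withDensity_apply _ MeasurableSet.univ, setLIntegral_univ,
    ← ofReal_integral_eq_lintegral_ofReal hf (Eventually.of_forall h0), h1, ENNReal.ofReal_one]

theorem distribFun_eq_cdf {f : ℝ → ℝ} (hf : Integrable f) (h0 : ∀ x, 0 ≤ f x)
    (h1 : ∫ x, f x = 1) (t : ℝ) :
    distribFun f t = cdf (volume.withDensity fun x => ENNReal.ofReal (f x)) t := by
  have := isProbabilityMeasure_withDensity_ofReal hf h0 h1
  rw [cdf_eq_real, measureReal_def, ofReal_distribFun hf h0, ENNReal.toReal_ofReal]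
  exact integral_nonneg h0

/-- The density of the standard Gaussian law. -/
noncomputable abbrev stdGauss : ℝ → ℝ := gaussianPDFReal 0 1

theorem continuous_stdGauss : Continuous stdGauss := by
  unfold stdGauss gaussianPDFReal
  fun_prop

theorem stdGauss_pos (x : ℝ) : 0 < stdGauss x := gaussianPDFReal_pos 0 1 x one_ne_zero

theorem integrable_stdGauss : Integrable stdGauss := integrable_gaussianPDFReal 0 1

theorem integral_stdGauss : ∫ x, stdGauss x = 1 := integral_gaussianPDFReal_eq_one 0 one_ne_zero

theorem gaussianReal_eq_withDensity :
    gaussianReal 0 1 = volume.withDensity fun x => ENNReal.ofReal (stdGauss x) :=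
  gaussianReal_of_var_ne_zero 0 one_ne_zero

theorem strictMono_distribFun_stdGauss : StrictMono (distribFun stdGauss) := by
  refine strictMono_of_deriv_pos fun x => ?_
  rw [(hasDerivAt_distribFun_of_continuous integrable_stdGauss continuous_stdGauss x).deriv]
  exact stdGauss_pos x

theorem tendsto_distribFun_atBot {f : ℝ → ℝ} (hf : Integrable f) (h0 : ∀ x, 0 ≤ f x)
    (h1 : ∫ x, f x = 1) : Tendsto (distribFun f) atBot (𝓝 0) := by
  rw [show distribFun f = _ from funext (distribFun_eq_cdf hf h0 h1)]
  exact tendsto_cdf_atBot _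

theorem tendsto_distribFun_atTop {f : ℝ → ℝ} (hf : Integrable f) (h0 : ∀ x, 0 ≤ f x)
    (h1 : ∫ x, f x = 1) : Tendsto (distribFun f) atTop (𝓝 1) := by
  rw [show distribFun f = _ from funext (distribFun_eq_cdf hf h0 h1)]
  exact tendsto_cdf_atTop _

theorem distribFun_stdGauss_mem_Ioo (x : ℝ) : distribFun stdGauss x ∈ Ioo (0 : ℝ) 1 := by
  have h0 := fun x => (stdGauss_pos x).le
  have hm := strictMono_distribFun_stdGauss
  constructor
  · refine lt_of_le_of_lt ?_ (hm (sub_one_lt x))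
    exact hm.monotone.le_of_tendsto
      (tendsto_distribFun_atBot integrable_stdGauss h0 integral_stdGauss) _
  · refine lt_of_lt_of_le (hm (lt_add_one x)) ?_
    exact hm.monotone.ge_of_tendsto
      (tendsto_distribFun_atTop integrable_stdGauss h0 integral_stdGauss) _

/-- The monotone map transporting the standard Gaussian law onto the law with density `f`. -/
noncomputable def gaussTransport (f : ℝ → ℝ) (x : ℝ) : ℝ :=
  sInf {t | distribFun stdGauss x ≤ distribFun f t}

variable {f : ℝ → ℝ}

/-- The infimum is attained: the set is closed because `distribFun f` is continuous, and it is
nonempty and bounded below because the Gaussian distribution function lies strictly between the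
limits `0` and `1`. All later facts on the transport come from this Galois connection. -/
theorem gaussTransport_le_iff (hf : Integrable f) (h0 : ∀ x, 0 ≤ f x) (h1 : ∫ x, f x = 1)
    (x t : ℝ) : gaussTransport f x ≤ t ↔ distribFun stdGauss x ≤ distribFun f t := by
  obtain ⟨hx0, hx1⟩ := distribFun_stdGauss_mem_Ioo x
  have hne : {t | distribFun stdGauss x ≤ distribFun f t}.Nonempty :=
    ((tendsto_distribFun_atTop hf h0 h1).eventually (lt_mem_nhds hx1)).exists.imp fun _ h => h.le
  have hbdd : BddBelow {t | distribFun stdGauss x ≤ distribFun f t} := by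
    obtain ⟨b, hb⟩ := ((tendsto_distribFun_atBot hf h0 h1).eventually (gt_mem_nhds hx0)).exists
    refine ⟨b, fun t ht => ?_⟩
    by_contra! hlt
    exact absurd (ht.trans (monotone_distribFun hf h0 hlt.le)) (not_le.2 hb)
  have hcl : IsClosed {t | distribFun stdGauss x ≤ distribFun f t} :=
    isClosed_le continuous_const (continuous_distribFun hf)
  constructor
  · intro h
    exact (hcl.csInf_mem hne hbdd : _ ≤ _).trans (monotone_distribFun hf h0 h)
  · intro h
    exact csInf_le hbdd h

theorem distribFun_gaussTransport (hf : Integrable f) (h0 : ∀ x, 0 ≤ f x) (h1 : ∫ x, f x = 1)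
    (x : ℝ) : distribFun f (gaussTransport f x) = distribFun stdGauss x := by
  refine le_antisymm ?_ ((gaussTransport_le_iff hf h0 h1 x _).1 le_rfl)
  refine le_of_tendsto ((continuous_distribFun hf).continuousWithinAt
    (s := Iio (gaussTransport f x))) ?_
  filter_upwards [self_mem_nhdsWithin] with t ht
  by_contra! h
  exact absurd ((gaussTransport_le_iff hf h0 h1 x t).2 h.le) (not_le.2 ht)

theorem monotone_gaussTransport (hf : Integrable f) (h0 : ∀ x, 0 ≤ f x) (h1 : ∫ x, f x = 1) :
    Monotone (gaussTransport f) := fun x y hxy =>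
  (gaussTransport_le_iff hf h0 h1 x _).2 <|
    (strictMono_distribFun_stdGauss.monotone hxy).trans (distribFun_gaussTransport hf h0 h1 y).ge

theorem map_gaussTransport (hf : Integrable f) (h0 : ∀ x, 0 ≤ f x) (h1 : ∫ x, f x = 1) :
    (gaussianReal 0 1).map (gaussTransport f)
      = volume.withDensity fun x => ENNReal.ofReal (f x) := by
  have hm := (monotone_gaussTransport hf h0 h1).measurable
  have := isProbabilityMeasure_withDensity_ofReal hf h0 h1
  have : IsProbabilityMeasure ((gaussianReal 0 1).map (gaussTransport f)) :=
    Measure.isProbabilityMeasure_map hm.aemeasurable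
  have hg0 := fun x => (stdGauss_pos x).le
  refine Measure.ext_of_Iic _ _ fun t => ?_
  rw [Measure.map_apply hm measurableSet_Iic, ofReal_distribFun hf h0]
  have hset : gaussTransport f ⁻¹' Iic t
      = {x | distribFun stdGauss x ≤ distribFun f t} := by
    ext x
    exact gaussTransport_le_iff hf h0 h1 x t
  rw [hset]
  have hle1 : distribFun f t ≤ 1 :=
    (monotone_distribFun hf h0).ge_of_tendsto (tendsto_distribFun_atTop hf h0 h1) t
  have hge0 : 0 ≤ distribFun f t := integral_nonneg h0
  rcases hge0.eq_or_lt with h | hpos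
  · rw [← h]
    have : {x | distribFun stdGauss x ≤ 0} = ∅ :=
      eq_empty_of_forall_notMem fun x hx => absurd hx (not_le.2 (distribFun_stdGauss_mem_Ioo x).1)
    simp [this]
  rcases hle1.eq_or_lt with h | hlt
  · rw [h]
    have : {x | distribFun stdGauss x ≤ 1} = univ :=
      eq_univ_of_forall fun x => (distribFun_stdGauss_mem_Ioo x).2.le
    simp [this]
  · obtain ⟨z, hz⟩ : ∃ z, distribFun stdGauss z = distribFun f t :=
      mem_range_of_exists_le_of_exists_ge (continuous_distribFun integrable_stdGauss)
        (((tendsto_distribFun_atBot integrable_stdGauss hg0 integral_stdGauss).eventually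
          (gt_mem_nhds hpos)).exists.imp fun _ h => h.le)
        (((tendsto_distribFun_atTop integrable_stdGauss hg0 integral_stdGauss).eventually
          (lt_mem_nhds hlt)).exists.imp fun _ h => h.le)
    have : {x | distribFun stdGauss x ≤ distribFun f t} = Iic z := by
      ext x
      simp [← hz, strictMono_distribFun_stdGauss.le_iff_le]
    rw [this, gaussianReal_eq_withDensity, ofReal_distribFun integrable_stdGauss hg0, hz]

/-- No regularity of `f` is needed. Lebesgue differentiation gives `F' = f > 0` almost everywhere
for the law with density `f`; this pulls back along the transport, and the Gaussian law has the same
null sets as Lebesgue measure. Then `F ∘ T = Φ` is differentiated through slopes. -/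
theorem ae_hasDerivAt_gaussTransport (hfm : Measurable f) (hf : Integrable f) (h0 : ∀ x, 0 ≤ f x)
    (h1 : ∫ x, f x = 1) :
    ∀ᵐ x, 0 < f (gaussTransport f x) ∧
      HasDerivAt (gaussTransport f) (stdGauss x / f (gaussTransport f x)) x := by
  have hm := (monotone_gaussTransport hf h0 h1).measurable
  have key : ∀ᵐ y ∂(volume.withDensity fun x => ENNReal.ofReal (f x)),
      0 < f y ∧ HasDerivAt (distribFun f) (f y) y := by
    rw [ae_withDensity_iff hfm.ennreal_ofReal]
    filter_upwards [ae_hasDerivAt_distribFun hf] with y hy hne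
    exact ⟨by simpa using hne, hy⟩
  rw [← map_gaussTransport hf h0 h1] at key
  have key2 := (gaussianReal_absolutelyContinuous' 0 one_ne_zero).ae_le
    (ae_of_ae_map hm.aemeasurable key)
  filter_upwards [key2] with x hx
  obtain ⟨hpos, hd⟩ := hx
  refine ⟨hpos, ?_⟩
  set T := gaussTransport f
  have hΦ := hasDerivAt_distribFun_of_continuous integrable_stdGauss continuous_stdGauss x
  have hcomp : ∀ y, distribFun f (T y) = distribFun stdGauss y :=
    distribFun_gaussTransport hf h0 h1
  rw [hasDerivAt_iff_tendsto_slope] at hd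
  -- A jump of `T` at `x` would need a flat piece of `F` just to the right of `T x`, which `F' (T x)
  -- > 0` forbids.
  have hcont : ContinuousAt T x := by
    refine tendsto_order.2 ⟨fun a ha => ?_, fun a ha => ?_⟩
    · have : distribFun f a < distribFun stdGauss x :=
        not_le.1 fun h => absurd ((gaussTransport_le_iff hf h0 h1 x a).2 h) (not_le.2 ha)
      filter_upwards [hΦ.continuousAt.eventually (lt_mem_nhds this)] with y hy
      exact not_le.1 fun h => absurd ((gaussTransport_le_iff hf h0 h1 y a).1 h) (not_le.2 hy)
    · have hev : ∀ᶠ t in 𝓝[>] (T x), 0 < slope (distribFun f) (T x) t :=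
        (hd.mono_left (nhdsWithin_mono _ fun t (ht : T x < t) => ht.ne')).eventually
          (lt_mem_nhds hpos)
      obtain ⟨t, ht, hat⟩ := (hev.and (Ioo_mem_nhdsGT ha)).exists
      have hlt : distribFun stdGauss x < distribFun f t := by
        rw [← hcomp x]
        rw [slope_def_field, div_pos_iff_of_pos_right (sub_pos.2 hat.1)] at ht
        linarith
      filter_upwards [hΦ.continuousAt.eventually (gt_mem_nhds hlt)] with y hy
      exact ((gaussTransport_le_iff hf h0 h1 y t).2 hy.le).trans_lt hat.2
  have hne : ∀ y, y ≠ x → T y ≠ T x := fun y hy h => hy <|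
    strictMono_distribFun_stdGauss.injective (by rw [← hcomp, ← hcomp, h])
  rw [hasDerivAt_iff_tendsto_slope] at hΦ ⊢
  have hT : Tendsto T (𝓝[≠] x) (𝓝[≠] (T x)) :=
    tendsto_nhdsWithin_iff.2 ⟨hcont.tendsto.mono_left nhdsWithin_le_nhds,
      eventually_mem_nhdsWithin.mono hne⟩
  have hlim := hΦ.div (hd.comp hT) hpos.ne'
  refine hlim.congr' ?_
  filter_upwards [self_mem_nhdsWithin] with y hy
  have hyx : y - x ≠ 0 := sub_ne_zero.2 hy
  have hTyx : T y - T x ≠ 0 := sub_ne_zero.2 (hne y hy)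
  have hΦne : distribFun stdGauss y - distribFun stdGauss x ≠ 0 :=
    sub_ne_zero.2 fun h => hy (strictMono_distribFun_stdGauss.injective h)
  simp only [Pi.div_apply, Function.comp, slope_def_field, hcomp]
  field_simp

end Transport

/-! ### The functional inequality on the line, for probability densities -/

section LineInequality

open Set Filter Topology Real

/-- The integrand `a b (log t - c² log a - s² log b)`, written so that it is continuous at
`a = 0` and `b = 0`. -/
noncomputable def entropyKernel (c s a b t : ℝ) : ℝ :=
  a * b * log t + c ^ 2 * (negMulLog a * b) + s ^ 2 * (a * negMulLog b)

/-- The map is multiplication by the unit complex number `c + i s`, an isometry of `ℂ`. -/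
theorem measurePreserving_rotation {c s : ℝ} (h : c ^ 2 + s ^ 2 = 1) :
    MeasurePreserving (fun p : ℝ × ℝ => (c * p.1 - s * p.2, s * p.1 + c * p.2))
      (volume.prod volume) (volume.prod volume) := by
  have hz : (⟨c, s⟩ : ℂ) ∈ Submonoid.unitSphere ℂ := by
    change (⟨c, s⟩ : ℂ) ∈ Metric.sphere (0 : ℂ) 1
    rw [mem_sphere_zero_iff_norm, Complex.norm_def, Complex.normSq_mk,
      show c * c + s * s = 1 by linarith, Real.sqrt_one]
  have h1 := Complex.volume_preserving_equiv_real_prod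
  have h2 := (rotation (⟨⟨c, s⟩, hz⟩ : Circle)).measurePreserving
  have h3 := (h1.comp h2).comp h1.symm
  convert! h3 using 1
  funext p
  have hrot : ∀ z : ℂ, rotation (⟨⟨c, s⟩, hz⟩ : Circle) z = ⟨c, s⟩ * z := fun z => rfl
  ext <;> simp [hrot, add_comm]

/-- A linear combination of rotated monotone maps does not increase the mass of a density. -/
theorem lintegral_monotone_combination_le {c s : ℝ} (hc : 0 ≤ c) (hs : 0 ≤ s)
    {T U T' U' : ℝ → ℝ} (hT : Monotone T) (hU : Monotone U) {A B : Set ℝ} (hA : MeasurableSet A)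
    (hB : MeasurableSet B) (hT' : ∀ x ∈ A, HasDerivAt T (T' x) x)
    (hU' : ∀ x ∈ B, HasDerivAt U (U' x) x) (q : ℝ → ENNReal) (y : ℝ) :
    ∫⁻ x in {x | c * x - s * y ∈ A ∧ s * x + c * y ∈ B},
      ENNReal.ofReal (c ^ 2 * T' (c * x - s * y) + s ^ 2 * U' (s * x + c * y)) *
        q (c * T (c * x - s * y) + s * U (s * x + c * y)) ≤ ∫⁻ x, q x := by
  have hm : MeasurableSet {x | c * x - s * y ∈ A ∧ s * x + c * y ∈ B} :=
    (hA.preimage (by fun_prop : Measurable fun x => c * x - s * y)).inter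
      (hB.preimage (by fun_prop : Measurable fun x => s * x + c * y))
  rw [← lintegral_image_eq_lintegral_deriv_mul_of_monotoneOn hm (f := fun x =>
    c * T (c * x - s * y) + s * U (s * x + c * y))]
  · exact setLIntegral_le_lintegral _ _
  · intro x hx
    have e1 : HasDerivAt (fun x => c * x - s * y) c x := by
      simpa using ((hasDerivAt_id x).const_mul c).sub_const (s * y)
    have e2 : HasDerivAt (fun x => s * x + c * y) s x := by
      simpa using ((hasDerivAt_id x).const_mul s).add_const (c * y)
    have d1 := ((hT' _ hx.1).comp x e1).const_mul c
    have d2 := ((hU' _ hx.2).comp x e2).const_mul s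
    refine ((d1.add d2).congr_deriv ?_).hasDerivWithinAt
    ring
  · intro x _ x' _ hxx'
    have e1 : c * x - s * y ≤ c * x' - s * y := by gcongr
    have e2 : s * x + c * y ≤ s * x' + c * y := by gcongr
    exact add_le_add (mul_le_mul_of_nonneg_left (hT e1) hc) (mul_le_mul_of_nonneg_left (hU e2) hs)

theorem log_stdGauss (x : ℝ) : log (stdGauss x) = log (√(2 * π))⁻¹ - x ^ 2 / 2 := by
  have h : (√(2 * π))⁻¹ ≠ 0 := by positivity
  rw [stdGauss, gaussianPDFReal, NNReal.coe_one, mul_one, mul_one, sub_zero,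
    Real.log_mul h (Real.exp_ne_zero _), Real.log_exp]
  ring

theorem stdGauss_mul_stdGauss {c s : ℝ} (h : c ^ 2 + s ^ 2 = 1) (x y : ℝ) :
    stdGauss (c * x - s * y) * stdGauss (s * x + c * y) = stdGauss x * stdGauss y := by
  apply Real.log_injOn_pos (mul_pos (stdGauss_pos _) (stdGauss_pos _))
    (mul_pos (stdGauss_pos _) (stdGauss_pos _))
  rw [log_mul (stdGauss_pos _).ne' (stdGauss_pos _).ne',
    log_mul (stdGauss_pos _).ne' (stdGauss_pos _).ne']
  simp only [log_stdGauss]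
  linear_combination (-(x ^ 2 + y ^ 2) / 2) * h

/-- After rotation the Gaussian weight depends on the second coordinate alone. Along each line where
it is fixed, the one-dimensional monotone change of variables bounds the integral by the mass of
`q`, and the weight has total mass one. -/
theorem lintegral_rotated_combination_le {c s : ℝ} (hc : 0 ≤ c) (hs : 0 ≤ s)
    (h : c ^ 2 + s ^ 2 = 1)
    {T U T' U' : ℝ → ℝ} (hT : Monotone T) (hU : Monotone U) {A B : Set ℝ} (hA : MeasurableSet A)
    (hB : MeasurableSet B) (hT' : ∀ x ∈ A, HasDerivAt T (T' x) x)
    (hU' : ∀ x ∈ B, HasDerivAt U (U' x) x) (hTm : Measurable T') (hUm : Measurable U')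
    {q : ℝ → ENNReal} (hq : Measurable q) :
    ∫⁻ p in A ×ˢ B, ENNReal.ofReal (stdGauss (c * p.2 - s * p.1)) *
      (ENNReal.ofReal (c ^ 2 * T' p.1 + s ^ 2 * U' p.2) * q (c * T p.1 + s * U p.2))
        ∂(volume.prod volume) ≤ ∫⁻ x, q x := by
  have hγ : Measurable fun x => ENNReal.ofReal (stdGauss x) :=
    continuous_stdGauss.measurable.ennreal_ofReal
  have hTme := hT.measurable
  have hUme := hU.measurable
  set F : ℝ × ℝ → ENNReal := fun p => ENNReal.ofReal (stdGauss (c * p.2 - s * p.1)) *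
      (ENNReal.ofReal (c ^ 2 * T' p.1 + s ^ 2 * U' p.2) * q (c * T p.1 + s * U p.2)) with hF
  have hFm : Measurable F := by
    refine (hγ.comp (by fun_prop)).mul (Measurable.mul ?_ (hq.comp ?_))
    · exact Measurable.ennreal_ofReal (by fun_prop)
    · fun_prop
  set R : ℝ × ℝ → ℝ × ℝ := fun p => (c * p.1 - s * p.2, s * p.1 + c * p.2) with hR
  have hRp : MeasurePreserving R (volume.prod volume) (volume.prod volume) :=
    measurePreserving_rotation h
  rw [← lintegral_indicator (hA.prod hB),
    ← hRp.lintegral_comp (hFm.indicator (hA.prod hB)),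
    lintegral_prod_symm (fun p => (A ×ˢ B).indicator F (R p))
      ((hFm.indicator (hA.prod hB)).comp hRp.measurable).aemeasurable]
  calc ∫⁻ y, ∫⁻ x, (A ×ˢ B).indicator F (R (x, y))
      ≤ ∫⁻ y, ENNReal.ofReal (stdGauss y) * ∫⁻ x, q x := by
        refine lintegral_mono fun y => ?_
        refine le_trans (le_of_eq ?_) (mul_le_mul_right
          (lintegral_monotone_combination_le hc hs hT hU hA hB hT' hU' q y) _)
        have hm : MeasurableSet {x | c * x - s * y ∈ A ∧ s * x + c * y ∈ B} :=
          (hA.preimage (by fun_prop : Measurable fun x => c * x - s * y)).inter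
            (hB.preimage (by fun_prop : Measurable fun x => s * x + c * y))
        rw [← lintegral_const_mul' _ _ ENNReal.ofReal_ne_top, ← lintegral_indicator hm]
        refine lintegral_congr fun x => ?_
        by_cases hx : c * x - s * y ∈ A ∧ s * x + c * y ∈ B
        · rw [indicator_of_mem (show R (x, y) ∈ A ×ˢ B from hx),
            indicator_of_mem (show x ∈ {x | c * x - s * y ∈ A ∧ s * x + c * y ∈ B} from hx)]
          have : c * (s * x + c * y) - s * (c * x - s * y) = y := by
            linear_combination y * h
          simp [hF, hR, this]
        · rw [indicator_of_notMem (show R (x, y) ∉ A ×ˢ B from hx),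
            indicator_of_notMem (show x ∉ {x | c * x - s * y ∈ A ∧ s * x + c * y ∈ B} from hx)]
    _ = ∫⁻ x, q x := by
        rw [lintegral_mul_const _ hγ]
        have := lintegral_gaussianPDFReal_eq_one 0 (v := 1) one_ne_zero
        rw [this, one_mul]

/-- The integrand of the transported inequality, at points where the transports have
positive derivatives `stdGauss x / a` and `stdGauss y / b`. -/
theorem transported_integrand_le {c s : ℝ} (h : c ^ 2 + s ^ 2 = 1) {x y a b t m : ℝ}
    (ha : 0 < a) (hb : 0 < b) (ht : 0 < t) (hm : 0 < m) :
    log t - c ^ 2 * log a - s ^ 2 * log b ≤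
      t * (c ^ 2 * (stdGauss x / a) + s ^ 2 * (stdGauss y / b)) / stdGauss (c * x + s * y) / m
        - 1 + log m - c * s * (x * y) := by
  have hx := stdGauss_pos x
  have hy := stdGauss_pos y
  have hxy := stdGauss_pos (c * x + s * y)
  have hT := div_pos hx ha
  have hU := div_pos hy hb
  -- Concavity of `log` at the two derivatives, with weights `c²` and `s²`.
  have hconc := strictConcaveOn_log_Ioi.concaveOn.2 (mem_Ioi.2 hT) (mem_Ioi.2 hU)
    (sq_nonneg c) (sq_nonneg s) h
  simp only [smul_eq_mul] at hconc
  have hD : 0 < c ^ 2 * (stdGauss x / a) + s ^ 2 * (stdGauss y / b) := by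
    rcases (sq_nonneg c).eq_or_lt with h0 | h0
    · rw [← h0, zero_add] at h
      rw [← h0, h, zero_mul, zero_add, one_mul]
      exact hU
    · exact add_pos_of_pos_of_nonneg (mul_pos h0 hT) (mul_nonneg (sq_nonneg s) hU.le)
  set D := c ^ 2 * (stdGauss x / a) + s ^ 2 * (stdGauss y / b)
  have hlog := Real.log_le_sub_one_of_pos (div_pos (div_pos (mul_pos ht hD) hxy) hm)
  rw [log_div (div_pos (mul_pos ht hD) hxy).ne' hm.ne', log_div (mul_pos ht hD).ne' hxy.ne',
    log_mul ht.ne' hD.ne'] at hlog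
  rw [log_div hx.ne' ha.ne', log_div hy.ne' hb.ne'] at hconc
  simp only [log_stdGauss] at hconc hlog
  have hk : c ^ 2 * log (√(2 * π))⁻¹ + s ^ 2 * log (√(2 * π))⁻¹ = log (√(2 * π))⁻¹ := by
    rw [← add_mul, h, one_mul]
  -- The Gaussian terms collapse: `-(c x + s y)²/2 + c² x²/2 + s² y²/2 = -c s x y`.
  nlinarith

theorem integrable_mul_gaussianReal_prod :
    Integrable (fun p : ℝ × ℝ => p.1 * p.2) ((gaussianReal 0 1).prod (gaussianReal 0 1)) := by
  have : Integrable (fun x : ℝ => x) (gaussianReal 0 1) :=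
    (memLp_id_gaussianReal 1).integrable (by simp)
  exact this.mul_prod this

theorem integral_mul_gaussianReal_prod :
    ∫ p : ℝ × ℝ, p.1 * p.2 ∂((gaussianReal 0 1).prod (gaussianReal 0 1)) = 0 := by
  rw [integral_prod_mul (fun x : ℝ => x) (fun y : ℝ => y), integral_id_gaussianReal, zero_mul]

theorem entropyKernel_eq (c s : ℝ) {a b : ℝ} (t : ℝ) :
    entropyKernel c s a b t = (a * b) * (log t - c ^ 2 * log a - s ^ 2 * log b) := by
  simp only [entropyKernel, negMulLog]
  ring

/-- The entropy inequality on the line for probability densities. -/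
theorem integral_entropyKernel_le_log {c s : ℝ} (hc : 0 ≤ c) (hs : 0 ≤ s)
    (h : c ^ 2 + s ^ 2 = 1) {f g q : ℝ → ℝ} (hfm : Measurable f) (hgm : Measurable g)
    (hqm : Measurable q) (hf : Integrable f) (hg : Integrable g) (hq : Integrable q)
    (hf0 : ∀ x, 0 ≤ f x) (hg0 : ∀ x, 0 ≤ g x) (hq0 : ∀ x, 0 ≤ q x)
    (hf1 : ∫ x, f x = 1) (hg1 : ∫ x, g x = 1) (hqpos : 0 < ∫ x, q x)
    (hpos : ∀ x y, 0 < f x → 0 < g y → 0 < q (c * x + s * y))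
    (hJ : Integrable (fun p : ℝ × ℝ => entropyKernel c s (f p.1) (g p.2) (q (c * p.1 + s * p.2)))) :
    ∫ p : ℝ × ℝ, entropyKernel c s (f p.1) (g p.2) (q (c * p.1 + s * p.2)) ≤ log (∫ x, q x) := by
  set T := gaussTransport f
  set U := gaussTransport g
  have hT : Monotone T := monotone_gaussTransport hf hf0 hf1
  have hU : Monotone U := monotone_gaussTransport hg hg0 hg1
  have hTm := hT.measurable
  have hUm := hU.measurable
  set T' : ℝ → ℝ := fun x => stdGauss x / f (T x)
  set U' : ℝ → ℝ := fun x => stdGauss x / g (U x)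
  have hT'm : Measurable T' := continuous_stdGauss.measurable.div (hfm.comp hTm)
  have hU'm : Measurable U' := continuous_stdGauss.measurable.div (hgm.comp hUm)
  obtain ⟨A, hA, hAm, hAp⟩ := (ae_hasDerivAt_gaussTransport hfm hf hf0 hf1).exists_measurable_mem
  obtain ⟨B, hB, hBm, hBp⟩ := (ae_hasDerivAt_gaussTransport hgm hg hg0 hg1).exists_measurable_mem
  set Γ : Measure (ℝ × ℝ) := (gaussianReal 0 1).prod (gaussianReal 0 1)
  set m := ∫ x, q x
  set w : ℝ × ℝ → ℝ := fun p =>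
    log (q (c * p.1 + s * p.2)) - c ^ 2 * log (f p.1) - s ^ 2 * log (g p.2) with hw
  have hwm : Measurable w := by fun_prop
  have hfe : Measurable fun x => ENNReal.ofReal (f x) := hfm.ennreal_ofReal
  have hge : Measurable fun x => ENNReal.ofReal (g x) := hgm.ennreal_ofReal
  have hγe : Measurable fun x => ENNReal.ofReal (stdGauss x) :=
    continuous_stdGauss.measurable.ennreal_ofReal
  have hfge : Measurable fun p : ℝ × ℝ => ENNReal.ofReal (f p.1) * ENNReal.ofReal (g p.2) := by
    fun_prop
  -- the law of `(T, U)` under the Gaussian measure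
  have hmap : Γ.map (Prod.map T U) = (volume.prod volume).withDensity
      fun p : ℝ × ℝ => ENNReal.ofReal (f p.1) * ENNReal.ofReal (g p.2) := by
    rw [← prod_withDensity hfe hge, ← map_gaussTransport hf hf0 hf1,
      ← map_gaussTransport hg hg0 hg1, Measure.map_prod_map _ _ hTm hUm]
  have hJw : ∀ p : ℝ × ℝ, entropyKernel c s (f p.1) (g p.2) (q (c * p.1 + s * p.2))
      = (ENNReal.ofReal (f p.1) * ENNReal.ofReal (g p.2)).toReal • w p := fun p => by
    rw [entropyKernel_eq, ENNReal.toReal_mul, ENNReal.toReal_ofReal (hf0 _),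
      ENNReal.toReal_ofReal (hg0 _), smul_eq_mul]
  have hlt : ∀ᵐ p : ℝ × ℝ ∂(volume.prod volume),
      ENNReal.ofReal (f p.1) * ENNReal.ofReal (g p.2) < ⊤ :=
    Eventually.of_forall fun p => ENNReal.mul_lt_top ENNReal.ofReal_lt_top ENNReal.ofReal_lt_top
  have hint : ∫ p : ℝ × ℝ, entropyKernel c s (f p.1) (g p.2) (q (c * p.1 + s * p.2))
      = ∫ p, w (Prod.map T U p) ∂Γ := by
    rw [integral_congr_ae (Eventually.of_forall hJw), Measure.volume_eq_prod,
      ← integral_withDensity_eq_integral_toReal_smul hfge hlt, ← hmap,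
      integral_map (hTm.prodMap hUm).aemeasurable hwm.aestronglyMeasurable]
  have hwint : Integrable (fun p => w (Prod.map T U p)) Γ := by
    have : Integrable w (Γ.map (Prod.map T U)) := by
      rw [hmap, integrable_withDensity_iff_integrable_smul' hfge hlt]
      exact hJ.congr (Eventually.of_forall hJw)
    exact this.comp_measurable (hTm.prodMap hUm)
  -- the change of variables
  set τ : ℝ × ℝ → ℝ := fun p => q (c * T p.1 + s * U p.2) *
    (c ^ 2 * T' p.1 + s ^ 2 * U' p.2) / stdGauss (c * p.1 + s * p.2) with hτ
  have hτm : Measurable τ := by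
    have := continuous_stdGauss.measurable
    fun_prop
  have hT'0 : ∀ x, 0 ≤ T' x := fun x => div_nonneg (stdGauss_pos x).le (hf0 _)
  have hU'0 : ∀ x, 0 ≤ U' x := fun x => div_nonneg (stdGauss_pos x).le (hg0 _)
  have hD0 : ∀ p : ℝ × ℝ, 0 ≤ c ^ 2 * T' p.1 + s ^ 2 * U' p.2 := fun p =>
    add_nonneg (mul_nonneg (sq_nonneg c) (hT'0 _)) (mul_nonneg (sq_nonneg s) (hU'0 _))
  have hτ0 : ∀ p, 0 ≤ τ p := fun p =>
    div_nonneg (mul_nonneg (hq0 _) (hD0 p)) (stdGauss_pos _).le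
  have hΓ : Γ = (volume.prod volume).withDensity
      fun p : ℝ × ℝ => ENNReal.ofReal (stdGauss p.1) * ENNReal.ofReal (stdGauss p.2) := by
    rw [← prod_withDensity hγe hγe, ← gaussianReal_eq_withDensity]
  have hae : ∀ᵐ p : ℝ × ℝ ∂(volume.prod volume), p ∈ A ×ˢ B := by
    have h1 : ∀ᵐ p : ℝ × ℝ ∂(volume.prod volume), p.1 ∈ A :=
      Measure.quasiMeasurePreserving_fst.ae hA
    have h2 : ∀ᵐ p : ℝ × ℝ ∂(volume.prod volume), p.2 ∈ B :=
      Measure.quasiMeasurePreserving_snd.ae hB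
    filter_upwards [h1, h2] with p h1 h2 using ⟨h1, h2⟩
  have hτle : ∫⁻ p, ENNReal.ofReal (τ p) ∂Γ ≤ ENNReal.ofReal m := by
    rw [hΓ, lintegral_withDensity_eq_lintegral_mul _ (by fun_prop) hτm.ennreal_ofReal,
      ofReal_integral_eq_lintegral_ofReal hq (Eventually.of_forall hq0)]
    refine le_trans (le_of_eq ?_) (lintegral_rotated_combination_le hc hs h hT hU hAm hBm
      (fun x hx => (hAp x hx).2) (fun x hx => (hBp x hx).2) hT'm hU'm hqm.ennreal_ofReal)
    rw [Measure.restrict_eq_self_of_ae_mem hae]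
    refine lintegral_congr fun p => ?_
    simp only [Pi.mul_apply]
    rw [← ENNReal.ofReal_mul (stdGauss_pos _).le, ← ENNReal.ofReal_mul (hD0 p),
      ← ENNReal.ofReal_mul (stdGauss_pos _).le,
      ← ENNReal.ofReal_mul (mul_nonneg (stdGauss_pos _).le (stdGauss_pos _).le)]
    congr 1
    -- By rotation invariance `γ(x) γ(y) = γ(cx+sy) γ(cy-sx)`, so the denominator of `τ` cancels and
    -- leaves the weight `γ(cy-sx)`.
    have hrot := stdGauss_mul_stdGauss (c := c) (s := -s) (by rw [neg_sq]; exact h) p.1 p.2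
    rw [show c * p.1 - -s * p.2 = c * p.1 + s * p.2 by ring,
      show -s * p.1 + c * p.2 = c * p.2 - s * p.1 by ring] at hrot
    have hne := (stdGauss_pos (c * p.1 + s * p.2)).ne'
    rw [← hrot, hτ]
    field_simp
  have hτint : Integrable τ Γ := by
    refine ⟨hτm.aestronglyMeasurable, ?_⟩
    rw [hasFiniteIntegral_iff_ofReal (Eventually.of_forall hτ0)]
    exact hτle.trans_lt ENNReal.ofReal_lt_top
  have hτm1 : ∫ p, τ p ∂Γ ≤ m := by
    rw [integral_eq_lintegral_of_nonneg_ae (Eventually.of_forall hτ0) hτm.aestronglyMeasurable]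
    exact ENNReal.toReal_le_of_le_ofReal hqpos.le hτle
  have hxy : Integrable (fun p : ℝ × ℝ => c * s * (p.1 * p.2)) Γ :=
    integrable_mul_gaussianReal_prod.const_mul _
  have hb : ∀ᵐ p ∂Γ, w (Prod.map T U p) ≤ τ p / m - 1 + log m - c * s * (p.1 * p.2) := by
    have hac : Γ ≪ volume.prod volume := by rw [hΓ]; exact withDensity_absolutelyContinuous _ _
    filter_upwards [hac.ae_le hae] with p hp
    have hfp := (hAp _ hp.1).1
    have hgp := (hBp _ hp.2).1
    exact transported_integrand_le h hfp hgp (hpos _ _ hfp hgp) hqpos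
  rw [hint]
  have hI1 : Integrable (fun p => τ p / m - 1) Γ := (hτint.div_const m).sub (integrable_const _)
  have hI2 : Integrable (fun p => τ p / m - 1 + log m) Γ := hI1.add (integrable_const _)
  -- After integration the cross term vanishes and `(∫ τ) / m - 1 ≤ 0`; only `log m` remains.
  refine (integral_mono_ae hwint (hI2.sub hxy) hb).trans ?_
  simp only [Pi.sub_apply]
  rw [integral_sub hI2 hxy, integral_add hI1 (integrable_const _),
    integral_sub (hτint.div_const m) (integrable_const _), integral_div, integral_const_mul,
    integral_mul_gaussianReal_prod]
  have : (∫ p, τ p ∂Γ) / m ≤ 1 := (div_le_one hqpos).2 hτm1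
  simp
  linarith

end LineInequality

/-! ### Bounded functions with bounded support, and the normalized inequality in dimension one -/

section Tensorization

open Set Filter Topology Real

/-- A measurable function with values in `[0, M]` that vanishes outside the ball of radius `R`. -/
structure BddSupp {E : Type*} [NormedAddCommGroup E] [MeasurableSpace E] (f : E → ℝ) (R M : ℝ) :
    Prop where
  measurable : Measurable f
  nonneg : ∀ x, 0 ≤ f x
  le : ∀ x, f x ≤ M
  eq_zero : ∀ x, R < ‖x‖ → f x = 0

theorem BddSupp.mono {E : Type*} [NormedAddCommGroup E] [MeasurableSpace E] {u : E → ℝ}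
    {R M M' : ℝ} (hu : BddSupp u R M) (h : M ≤ M') : BddSupp u R M' :=
  { hu with le := fun x => (hu.le x).trans h }

/-- The functional form of Shannon's inequality, for bounded functions with bounded support. -/
def EntropyIneq (E : Type*) [NormedAddCommGroup E] [NormedSpace ℝ E] [MeasureSpace E]
    (c s : ℝ) : Prop :=
  ∀ (f g q : E → ℝ) (R M ε : ℝ), 0 < R → 0 < ε → BddSupp f R M → BddSupp g R M →
    BddSupp q (2 * R) M → (∀ x, ‖x‖ ≤ 2 * R → ε ≤ q x) →
    ∫ p : E × E, entropyKernel c s (f p.1) (g p.2) (q (c • p.1 + s • p.2)) ≤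
      entropyKernel c s (∫ x, f x) (∫ x, g x) (∫ x, q x)

@[simp]
theorem entropyKernel_zero_left (c s b t : ℝ) : entropyKernel c s 0 b t = 0 := by
  simp [entropyKernel]

@[simp]
theorem entropyKernel_zero_right (c s a t : ℝ) : entropyKernel c s a 0 t = 0 := by
  simp [entropyKernel]

theorem measurable_entropyKernel {α : Type*} [MeasurableSpace α] (c s : ℝ) {a b t : α → ℝ}
    (ha : Measurable a) (hb : Measurable b) (ht : Measurable t) :
    Measurable fun x => entropyKernel c s (a x) (b x) (t x) := by
  have h := continuous_negMulLog.measurable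
  unfold entropyKernel
  have h1 := h.comp ha
  have h2 := h.comp hb
  simp only [Function.comp_def] at h1 h2
  fun_prop

theorem exists_abs_negMulLog_le (M : ℝ) : ∃ C, 0 ≤ C ∧ ∀ a, 0 ≤ a → a ≤ M → |negMulLog a| ≤ C := by
  obtain ⟨C, hC⟩ := isCompact_Icc.exists_bound_of_continuousOn (s := Icc 0 M)
    continuous_negMulLog.continuousOn
  exact ⟨max C 0, le_max_right _ _, fun a h0 h1 => (hC a ⟨h0, h1⟩).trans (le_max_left _ _)⟩

theorem abs_log_le_of_mem {ε M t : ℝ} (hε : 0 < ε) (h1 : ε ≤ t) (h2 : t ≤ M) :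
    |log t| ≤ |log ε| + |log M| := by
  have ha := log_le_log hε h1
  have hb := log_le_log (hε.trans_le h1) h2
  rw [abs_le]
  constructor
  · linarith [neg_abs_le (log ε), abs_nonneg (log M)]
  · linarith [le_abs_self (log M), abs_nonneg (log ε)]

/-- Only `log t` can be unbounded, so a lower bound on `t` suffices; this is why `q` is kept above
`ε` on the ball of radius `2R`, which contains every relevant `c x + s y`. -/
theorem exists_abs_entropyKernel_le (c s M : ℝ) {ε : ℝ} (hε : 0 < ε) :
    ∃ C, ∀ a b t, 0 ≤ a → a ≤ M → 0 ≤ b → b ≤ M → ε ≤ t → t ≤ M →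
      |entropyKernel c s a b t| ≤ C := by
  obtain ⟨C, hC0, hC⟩ := exists_abs_negMulLog_le M
  refine ⟨M * M * (|log ε| + |log M|) + c ^ 2 * (C * M) + s ^ 2 * (M * C), ?_⟩
  intro a b t ha haM hb hbM ht htM
  have hM : 0 ≤ M := ha.trans haM
  refine (abs_add_three _ _ _).trans ?_
  simp only [abs_mul, abs_pow, sq_abs, abs_of_nonneg ha, abs_of_nonneg hb]
  have h1 := hC a ha haM
  have h2 := hC b hb hbM
  have h3 := abs_log_le_of_mem hε ht htM
  gcongr

theorem norm_combination_le {E : Type*} [NormedAddCommGroup E] [NormedSpace ℝ E] {c s R : ℝ}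
    (hc : |c| ≤ 1) (hs : |s| ≤ 1) {x y : E} (hx : ‖x‖ ≤ R) (hy : ‖y‖ ≤ R) : ‖c • x + s • y‖ ≤ 2 * R := by
  refine (norm_add_le _ _).trans ?_
  rw [norm_smul, norm_smul, Real.norm_eq_abs, Real.norm_eq_abs]
  have := mul_le_mul hc hx (norm_nonneg _) zero_le_one
  have := mul_le_mul hs hy (norm_nonneg _) zero_le_one
  linarith

section

variable {E : Type*} [NormedAddCommGroup E] [MeasureSpace E] [ProperSpace E]
  [IsFiniteMeasureOnCompacts (volume : Measure E)]

theorem BddSupp.integrable {f : E → ℝ} {R M : ℝ} (hf : BddSupp f R M) : Integrable f := by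
  have hfin : volume (Metric.closedBall (0 : E) R) < ⊤ :=
    (isCompact_closedBall 0 R).measure_lt_top
  have h1 : IntegrableOn f (Metric.closedBall 0 R) :=
    IntegrableOn.of_bound hfin hf.measurable.aestronglyMeasurable M
      (Eventually.of_forall fun x => by
        rw [Real.norm_eq_abs, abs_of_nonneg (hf.nonneg x)]; exact hf.le x)
  exact h1.integrable_of_forall_notMem_eq_zero fun x hx => hf.eq_zero x (by simpa using hx)

theorem BddSupp.integral_le [OpensMeasurableSpace E] {f : E → ℝ} {R M : ℝ} (hf : BddSupp f R M) :
    ∫ x, f x ≤ M * volume.real (Metric.closedBall (0 : E) R) := by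
  have hfin : volume (Metric.closedBall (0 : E) R) < ⊤ :=
    (isCompact_closedBall 0 R).measure_lt_top
  rw [← setIntegral_eq_integral_of_forall_compl_eq_zero (s := Metric.closedBall (0 : E) R)
    fun x hx => hf.eq_zero x (by simpa using hx)]
  refine (setIntegral_mono_on hf.integrable.integrableOn (integrableOn_const hfin.ne)
    Metric.isClosed_closedBall.measurableSet fun x _ => hf.le x).trans ?_
  rw [setIntegral_const, smul_eq_mul, mul_comm]

theorem BddSupp.le_integral [OpensMeasurableSpace E] {q : E → ℝ} {R M ε : ℝ} (hq : BddSupp q R M)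
    (hqε : ∀ x, ‖x‖ ≤ R → ε ≤ q x) :
    ε * volume.real (Metric.closedBall (0 : E) R) ≤ ∫ x, q x := by
  have hfin : volume (Metric.closedBall (0 : E) R) < ⊤ :=
    (isCompact_closedBall 0 R).measure_lt_top
  have h1 := setIntegral_mono_on (integrableOn_const hfin.ne) hq.integrable.integrableOn
    Metric.isClosed_closedBall.measurableSet fun x hx => hqε x (by simpa using hx)
  rw [setIntegral_const, smul_eq_mul, mul_comm] at h1
  exact h1.trans (setIntegral_le_integral hq.integrable (Eventually.of_forall hq.nonneg))

theorem measureReal_closedBall_pos [Measure.IsOpenPosMeasure (volume : Measure E)] {R : ℝ}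
    (hR : 0 < R) : 0 < volume.real (Metric.closedBall (0 : E) R) :=
  ENNReal.toReal_pos (Metric.measure_closedBall_pos volume 0 hR).ne'
    (isCompact_closedBall 0 R).measure_lt_top.ne

end

theorem integrable_entropyKernel {E : Type*} [NormedAddCommGroup E] [NormedSpace ℝ E]
    [MeasureSpace E] [BorelSpace E] [SecondCountableTopology E] [ProperSpace E]
    [IsFiniteMeasureOnCompacts (volume : Measure E)] {c s : ℝ} (hc : |c| ≤ 1) (hs : |s| ≤ 1) {f g q : E → ℝ}
    {R M ε : ℝ} (hε : 0 < ε) (hf : BddSupp f R M) (hg : BddSupp g R M) (hq : BddSupp q (2 * R) M)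
    (hqε : ∀ x, ‖x‖ ≤ 2 * R → ε ≤ q x) :
    Integrable fun p : E × E => entropyKernel c s (f p.1) (g p.2) (q (c • p.1 + s • p.2)) := by
  obtain ⟨C, hC⟩ := exists_abs_entropyKernel_le c s M hε
  set K : Set (E × E) := Metric.closedBall 0 R ×ˢ Metric.closedBall 0 R with hK
  have hKc : IsCompact K := (isCompact_closedBall 0 R).prod (isCompact_closedBall 0 R)
  have hfin : volume K < ⊤ := by
    rw [hK, Measure.volume_eq_prod, Measure.prod_prod]
    exact ENNReal.mul_lt_top (isCompact_closedBall 0 R).measure_lt_top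
      (isCompact_closedBall 0 R).measure_lt_top
  have hm : Measurable fun p : E × E =>
      entropyKernel c s (f p.1) (g p.2) (q (c • p.1 + s • p.2)) :=
    measurable_entropyKernel c s (hf.measurable.comp measurable_fst)
      (hg.measurable.comp measurable_snd) (hq.measurable.comp (by fun_prop))
  have h1 : IntegrableOn (fun p : E × E =>
      entropyKernel c s (f p.1) (g p.2) (q (c • p.1 + s • p.2))) K := by
    refine IntegrableOn.of_bound hfin hm.aestronglyMeasurable C ?_
    filter_upwards [ae_restrict_mem hKc.isClosed.measurableSet] with p hp
    obtain ⟨hp1, hp2⟩ : ‖p.1‖ ≤ R ∧ ‖p.2‖ ≤ R := by simpa [hK] using hp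
    exact hC _ _ _ (hf.nonneg _) (hf.le _) (hg.nonneg _) (hg.le _)
      (hqε _ (norm_combination_le hc hs hp1 hp2)) (hq.le _)
  refine h1.integrable_of_forall_notMem_eq_zero fun p hp => ?_
  have : R < ‖p.1‖ ∨ R < ‖p.2‖ := by
    by_contra! hcon
    exact hp (by simpa [hK] using hcon)
  rcases this with h | h
  · rw [hf.eq_zero _ h, entropyKernel_zero_left]
  · rw [hg.eq_zero _ h, entropyKernel_zero_right]

/-- The functional inequality on the line. -/
theorem entropyIneq_real {c s : ℝ} (hc : 0 ≤ c) (hs : 0 ≤ s) (h : c ^ 2 + s ^ 2 = 1) :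
    EntropyIneq ℝ c s := by
  intro f g q R M ε hR hε hf hg hq hqε
  have hc1 : |c| ≤ 1 := abs_le_one_iff_mul_self_le_one.2 (by nlinarith)
  have hs1 : |s| ≤ 1 := abs_le_one_iff_mul_self_le_one.2 (by nlinarith)
  have hJ := integrable_entropyKernel hc1 hs1 hε hf hg hq hqε
  have ha0 : 0 ≤ ∫ x, f x := integral_nonneg hf.nonneg
  have hb0 : 0 ≤ ∫ x, g x := integral_nonneg hg.nonneg
  rcases ha0.eq_or_lt with ha | ha
  · have hz : f =ᵐ[volume] 0 := (integral_eq_zero_iff_of_nonneg hf.nonneg hf.integrable).1 ha.symm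
    rw [← ha, entropyKernel_zero_left]
    refine (integral_eq_zero_of_ae ?_).le
    filter_upwards [Measure.quasiMeasurePreserving_fst.ae hz] with p hp
    rw [hp, Pi.zero_apply, entropyKernel_zero_left, Pi.zero_apply]
  rcases hb0.eq_or_lt with hb | hb
  · have hz : g =ᵐ[volume] 0 := (integral_eq_zero_iff_of_nonneg hg.nonneg hg.integrable).1 hb.symm
    rw [← hb, entropyKernel_zero_right]
    refine (integral_eq_zero_of_ae ?_).le
    filter_upwards [Measure.quasiMeasurePreserving_snd.ae hz] with p hp
    rw [hp, Pi.zero_apply, entropyKernel_zero_right, Pi.zero_apply]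
  set a := ∫ x, f x
  set b := ∫ x, g x
  have hqpos : 0 < ∫ x, q x :=
    (mul_pos hε (measureReal_closedBall_pos (by linarith))).trans_le (hq.le_integral hqε)
  -- Normalizing `f` and `g` to mass one adds `c² log a + s² log b` times a probability density,
  -- which is the correction on the right side for general masses.
  have hkey : ∀ p : ℝ × ℝ, entropyKernel c s (a⁻¹ * f p.1) (b⁻¹ * g p.2) (q (c * p.1 + s * p.2))
      = (a * b)⁻¹ * entropyKernel c s (f p.1) (g p.2) (q (c • p.1 + s • p.2)) +
        (c ^ 2 * log a + s ^ 2 * log b) * (a⁻¹ * f p.1 * (b⁻¹ * g p.2)) := by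
    intro p
    rcases (hf.nonneg p.1).eq_or_lt with h0 | h0
    · simp [← h0]
    rcases (hg.nonneg p.2).eq_or_lt with h1 | h1
    · simp [← h1]
    simp only [entropyKernel_eq, smul_eq_mul]
    rw [log_mul (inv_pos.2 ha).ne' h0.ne', log_mul (inv_pos.2 hb).ne' h1.ne', log_inv, log_inv,
      mul_inv]
    ring
  have hfi := hf.integrable.const_mul a⁻¹
  have hgi := hg.integrable.const_mul b⁻¹
  have hf1 : ∫ x, a⁻¹ * f x = 1 := by rw [integral_const_mul]; exact inv_mul_cancel₀ ha.ne'
  have hg1 : ∫ x, b⁻¹ * g x = 1 := by rw [integral_const_mul]; exact inv_mul_cancel₀ hb.ne'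
  have hI : Integrable fun p : ℝ × ℝ => (c ^ 2 * log a + s ^ 2 * log b) *
      (a⁻¹ * f p.1 * (b⁻¹ * g p.2)) := (hfi.mul_prod hgi).const_mul _
  have hI' : Integrable fun p : ℝ × ℝ =>
      (a * b)⁻¹ * entropyKernel c s (f p.1) (g p.2) (q (c • p.1 + s • p.2)) := hJ.const_mul _
  have hmain := integral_entropyKernel_le_log hc hs h (hf.measurable.const_mul a⁻¹)
    (hg.measurable.const_mul b⁻¹) hq.measurable hfi hgi hq.integrable
    (fun x => mul_nonneg (inv_pos.2 ha).le (hf.nonneg x))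
    (fun x => mul_nonneg (inv_pos.2 hb).le (hg.nonneg x)) hq.nonneg hf1 hg1 hqpos
    (fun x y hx hy => by
      have hx' : ‖x‖ ≤ R := not_lt.1 fun hlt => by simp [hf.eq_zero x hlt] at hx
      have hy' : ‖y‖ ≤ R := not_lt.1 fun hlt => by simp [hg.eq_zero y hlt] at hy
      exact hε.trans_le (hqε _ (norm_combination_le hc1 hs1 hx' hy')))
    ((hI'.add hI).congr (Eventually.of_forall fun p => (hkey p).symm))
  rw [integral_congr_ae (Eventually.of_forall hkey), integral_add hI' hI, integral_const_mul,
    integral_const_mul, Measure.volume_eq_prod, integral_prod_mul (fun x => a⁻¹ * f x)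
    (fun y => b⁻¹ * g y), hf1, hg1, ← le_sub_iff_add_le, inv_mul_le_iff₀ (mul_pos ha hb)] at hmain
  refine hmain.trans (le_of_eq ?_)
  rw [entropyKernel_eq]
  ring

end Tensorization

/-! ### Passage to products -/

section Product

open Set Filter Topology Real

/-- This groups the two `E`-coordinates and the two `F`-coordinates, so that Fubini can integrate
over the `F`-pair first. -/
theorem measurePreserving_prodProdProdComm {α β γ δ : Type*} [MeasureSpace α] [MeasureSpace β]
    [MeasureSpace γ] [MeasureSpace δ] [SFinite (volume : Measure α)]
    [SFinite (volume : Measure β)] [SFinite (volume : Measure γ)] [SFinite (volume : Measure δ)] :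
    MeasurePreserving (fun p : (α × γ) × (β × δ) => ((p.1.1, p.2.1), (p.1.2, p.2.2))) := by
  have h1 : MeasurePreserving (MeasurableEquiv.prodAssoc : (α × γ) × (β × δ) ≃ᵐ _) :=
    volume_preserving_prodAssoc
  have h2 : MeasurePreserving (MeasurableEquiv.prodAssoc : (γ × β) × δ ≃ᵐ _) :=
    volume_preserving_prodAssoc
  have h3 : MeasurePreserving (Prod.swap : γ × β → β × γ) := Measure.measurePreserving_swap
  have h4 : MeasurePreserving (MeasurableEquiv.prodAssoc : (β × γ) × δ ≃ᵐ _) :=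
    volume_preserving_prodAssoc
  have h5 : MeasurePreserving (MeasurableEquiv.prodAssoc : (α × β) × (γ × δ) ≃ᵐ _) :=
    volume_preserving_prodAssoc
  have h6 := (h4.comp (h3.prod (MeasurePreserving.id (volume : Measure δ)))).comp h2.symm
  exact h5.symm.comp (((MeasurePreserving.id (volume : Measure α)).prod h6).comp h1)

theorem BddSupp.slice {E F : Type*} [NormedAddCommGroup E] [MeasurableSpace E]
    [NormedAddCommGroup F] [MeasurableSpace F] {f : E × F → ℝ} {R M : ℝ} (hf : BddSupp f R M) (x : E) :
    BddSupp (fun y => f (x, y)) R M where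
  measurable := hf.measurable.comp measurable_prodMk_left
  nonneg _ := hf.nonneg _
  le _ := hf.le _
  eq_zero _ hy := hf.eq_zero _ (hy.trans_le (le_max_right _ _))

theorem BddSupp.slice_eq_zero {E F : Type*} [NormedAddCommGroup E] [MeasurableSpace E]
    [NormedAddCommGroup F] [MeasurableSpace F] {f : E × F → ℝ} {R M : ℝ} (hf : BddSupp f R M) {x : E}
    (hx : R < ‖x‖) (y : F) : f (x, y) = 0 :=
  hf.eq_zero _ (hx.trans_le (le_max_left _ _))

theorem BddSupp.marginal {E F : Type*} [NormedAddCommGroup E] [MeasurableSpace E]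
    [NormedAddCommGroup F] [MeasureSpace F] [OpensMeasurableSpace F] [SecondCountableTopology F]
    [ProperSpace F] [IsFiniteMeasureOnCompacts (volume : Measure F)] {f : E × F → ℝ} {R M M' : ℝ} (hf : BddSupp f R M)
    (hM : M * volume.real (Metric.closedBall (0 : F) R) ≤ M') :
    BddSupp (fun x => ∫ y, f (x, y)) R M' where
  measurable := (hf.measurable.stronglyMeasurable.integral_prod_right').measurable
  nonneg x := integral_nonneg fun y => hf.nonneg _
  le x := (hf.slice x).integral_le.trans hM
  eq_zero x hx := by simp [hf.slice_eq_zero hx]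

variable {E F : Type*} [NormedAddCommGroup E] [NormedSpace ℝ E] [MeasureSpace E] [BorelSpace E]
  [SecondCountableTopology E] [ProperSpace E] [IsFiniteMeasureOnCompacts (volume : Measure E)]
  [NormedAddCommGroup F] [NormedSpace ℝ F] [MeasureSpace F] [BorelSpace F]
  [SecondCountableTopology F] [ProperSpace F] [IsFiniteMeasureOnCompacts (volume : Measure F)]
  [Measure.IsOpenPosMeasure (volume : Measure F)]

/-- The functional inequality passes to products. -/
theorem EntropyIneq.prod {c s : ℝ} (hc : |c| ≤ 1) (hs : |s| ≤ 1) (hE : EntropyIneq E c s)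
    (hF : EntropyIneq F c s) : EntropyIneq (E × F) c s := by
  intro f g q R M ε hR hε hf hg hq hqε
  have hM : 0 ≤ M := (hf.nonneg 0).trans (hf.le 0)
  have hJ := integrable_entropyKernel hc hs hε hf hg hq hqε
  -- The radius `2 * R` gives one bound for all three marginals, as `q` has the larger support.
  set M' := M * volume.real (Metric.closedBall (0 : F) (2 * R)) with hM'
  have hRM' : M * volume.real (Metric.closedBall (0 : F) R) ≤ M' := by
    refine mul_le_mul_of_nonneg_left (measureReal_mono (Metric.closedBall_subset_closedBall
      (by linarith)) (isCompact_closedBall 0 _).measure_lt_top.ne) hM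
  set f₁ : E → ℝ := fun x => ∫ y, f (x, y)
  set g₁ : E → ℝ := fun x => ∫ y, g (x, y)
  set q₁ : E → ℝ := fun x => ∫ y, q (x, y)
  have hf₁ : BddSupp f₁ R M' := hf.marginal hRM'
  have hg₁ : BddSupp g₁ R M' := hg.marginal hRM'
  have hq₁ : BddSupp q₁ (2 * R) M' := hq.marginal le_rfl
  set ε' := ε * volume.real (Metric.closedBall (0 : F) (2 * R))
  have hε' : 0 < ε' := mul_pos hε (measureReal_closedBall_pos (by linarith))
  have hqx : ∀ x : E, ‖x‖ ≤ 2 * R → ∀ y : F, ‖y‖ ≤ 2 * R → ε ≤ q (x, y) :=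
    fun x hx y hy => hqε _ (max_le hx hy)
  have hq₁ε : ∀ x, ‖x‖ ≤ 2 * R → ε' ≤ q₁ x := fun x hx => (hq.slice x).le_integral (hqx x hx)
  have hJ₁ := integrable_entropyKernel hc hs hε' hf₁ hg₁ hq₁ hq₁ε
  have hmain := hE f₁ g₁ q₁ R M' ε' hR hε' hf₁ hg₁ hq₁ hq₁ε
  have hfub : ∀ {u : E × F → ℝ} {r : ℝ}, BddSupp u r M → ∫ x, ∫ y, u (x, y) = ∫ p, u p :=
    fun hu => (integral_prod _ hu.integrable).symm
  rw [hfub hf, hfub hg, hfub hq] at hmain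
  refine le_trans ?_ hmain
  have hmp := measurePreserving_prodProdProdComm (α := E) (γ := E) (β := F) (δ := F)
  set H : (E × F) × (E × F) → ℝ := fun p =>
    entropyKernel c s (f p.1) (g p.2) (q (c • p.1 + s • p.2)) with hH
  set φ := fun p : (E × E) × (F × F) => ((p.1.1, p.2.1), (p.1.2, p.2.2))
  have hHm : Measurable H := measurable_entropyKernel c s (hf.measurable.comp measurable_fst)
      (hg.measurable.comp measurable_snd) (hq.measurable.comp (by fun_prop))
  have hHφ : Integrable (H ∘ φ) := hmp.integrable_comp_of_integrable hJ
  have heq : ∫ p, H p = ∫ p, H (φ p) := by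
    rw [← hmp.map_eq, integral_map hmp.measurable.aemeasurable hHm.aestronglyMeasurable]
  rw [heq, Measure.volume_eq_prod, integral_prod (fun p => H (φ p)) hHφ]
  refine integral_mono hHφ.integral_prod_left hJ₁ fun z => ?_
  -- The slice of `q` has its lower bound `ε` only when both base points lie in the ball of radius
  -- `R`; otherwise both sides are zero.
  by_cases hz1 : R < ‖z.1‖
  · have h0 := hf.slice_eq_zero hz1
    simp [hH, φ, f₁, h0]
  by_cases hz2 : R < ‖z.2‖
  · have h0 := hg.slice_eq_zero hz2
    simp [hH, φ, g₁, h0]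
  have hz : ‖c • z.1 + s • z.2‖ ≤ 2 * R := norm_combination_le hc hs (not_lt.1 hz1) (not_lt.1 hz2)
  exact hF _ _ _ R M ε hR hε (hf.slice z.1) (hg.slice z.2) (hq.slice _) (hqx _ hz)

end Product

/-! ### All dimensions, with the sup norm -/

section Transfer

open Set Filter Topology Real

/-- The functional inequality is invariant under norm and volume preserving linear maps. -/
theorem EntropyIneq.transfer {E F : Type*} [NormedAddCommGroup E] [NormedSpace ℝ E]
    [MeasureSpace E] [NormedAddCommGroup F] [NormedSpace ℝ F] [MeasureSpace F]
    [SFinite (volume : Measure E)] [SFinite (volume : Measure F)]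
    {c s : ℝ} (hF : EntropyIneq F c s) (e : E ≃ᵐ F) (he : MeasurePreserving e)
    (hlin : ∀ x y, e (c • x + s • y) = c • e x + s • e y) (hnorm : ∀ x, ‖e x‖ = ‖x‖) :
    EntropyIneq E c s := by
  intro f g q R M ε hR hε hf hg hq hqε
  have htr : ∀ {u : E → ℝ} {r : ℝ}, BddSupp u r M → BddSupp (u ∘ e.symm) r M := fun hu =>
    { measurable := hu.measurable.comp e.symm.measurable
      nonneg := fun x => hu.nonneg _
      le := fun x => hu.le _
      eq_zero := fun x hx => hu.eq_zero _ (by rwa [← hnorm, e.apply_symm_apply]) }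
  have hint : ∀ u : E → ℝ, ∫ x, (u ∘ e.symm) x = ∫ x, u x := fun u => by
    rw [← he.integral_comp' (u ∘ e.symm)]
    simp
  have h := hF _ _ _ R M ε hR hε (htr hf) (htr hg) (htr hq) fun x hx =>
    hqε _ (by rwa [← hnorm, e.apply_symm_apply])
  rw [hint f, hint g, hint q] at h
  refine le_trans (le_of_eq ?_) h
  rw [Measure.volume_eq_prod, Measure.volume_eq_prod,
    ← (he.prod he).integral_comp (e.prodCongr e).measurableEmbedding]
  refine integral_congr_ae (Eventually.of_forall fun p => ?_)
  simp [← hlin]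

theorem entropyIneq_pi {c s : ℝ} (hc : 0 ≤ c) (hs : 0 ≤ s) (h : c ^ 2 + s ^ 2 = 1) (n : ℕ) :
    EntropyIneq (Fin n → ℝ) c s := by
  have hc1 : |c| ≤ 1 := abs_le_one_iff_mul_self_le_one.2 (by nlinarith)
  have hs1 : |s| ≤ 1 := abs_le_one_iff_mul_self_le_one.2 (by nlinarith)
  induction n with
  | zero =>
    intro f g q R M ε hR hε hf hg hq hqε
    -- In dimension zero volume is a point mass, so the two sides agree.
    have h0 : (volume : Measure (Fin 0 → ℝ)) = Measure.dirac 0 := Measure.volume_pi_eq_dirac 0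
    rw [Measure.volume_eq_prod, h0, Measure.dirac_prod_dirac]
    simp
  | succ n ih =>
    refine ((entropyIneq_real hc hs h).prod hc1 hs1 ih).transfer
      (MeasurableEquiv.piFinSuccAbove (fun _ => ℝ) 0)
      (volume_preserving_piFinSuccAbove (fun _ => ℝ) 0) (fun x y => rfl) fun x => ?_
    refine le_antisymm (max_le (norm_le_pi_norm x 0)
      ((pi_norm_le_iff_of_nonneg (norm_nonneg _)).2 fun i => norm_le_pi_norm x _)) ?_
    refine (pi_norm_le_iff_of_nonneg (norm_nonneg _)).2 fun i => ?_
    refine Fin.cases ?_ (fun j => ?_) i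
    · exact le_max_left _ _
    · exact (norm_le_pi_norm (fun j : Fin n => x j.succ) j).trans (le_max_right _ _)

end Transfer

/-! ### The entropy inequality for bounded densities with bounded support -/

section Truncated

open Set Filter Topology Real

theorem BddSupp.integrable_negMulLog {E : Type*} [NormedAddCommGroup E] [MeasureSpace E]
    [ProperSpace E] [IsFiniteMeasureOnCompacts (volume : Measure E)] {f : E → ℝ} {R M : ℝ}
    (hf : BddSupp f R M) : Integrable fun x => negMulLog (f x) := by
  obtain ⟨C, -, hC⟩ := exists_abs_negMulLog_le M
  have hfin : volume (Metric.closedBall (0 : E) R) < ⊤ :=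
    (isCompact_closedBall 0 R).measure_lt_top
  have h1 : IntegrableOn (fun x => negMulLog (f x)) (Metric.closedBall 0 R) :=
    IntegrableOn.of_bound hfin
      (continuous_negMulLog.measurable.comp hf.measurable).aestronglyMeasurable C
      (Eventually.of_forall fun x => hC _ (hf.nonneg x) (hf.le x))
  refine h1.integrable_of_forall_notMem_eq_zero fun x hx => ?_
  rw [hf.eq_zero x (by simpa using hx), negMulLog_zero]

/-- `ρ` is the density of `c x + s y` when `(x, y)` has density `f x * g y`. -/
def IsCombDensity {E : Type*} [NormedAddCommGroup E] [NormedSpace ℝ E] [MeasureSpace E]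
    (c s : ℝ) (f g ρ : E → ℝ) : Prop :=
  ∀ h : E → ℝ, Measurable h → (∃ C, ∀ x, |h x| ≤ C) →
    ∫ z, h z * ρ z = ∫ p : E × E, h (c • p.1 + s • p.2) * (f p.1 * g p.2)

/-- The conclusion of the entropy inequality for functions of masses `∫ f` and `∫ g`. -/
def EntropyBound {E : Type*} [MeasureSpace E] (c s : ℝ) (f g ρ : E → ℝ) : Prop :=
  c ^ 2 * ((∫ x, negMulLog (f x)) * ∫ x, g x) + s ^ 2 * ((∫ x, f x) * ∫ x, negMulLog (g x)) ≤
    (∫ x, negMulLog (ρ x)) +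
      entropyKernel c s (∫ x, f x) (∫ x, g x) ((∫ x, f x) * ∫ x, g x)

/-- The choice `q = ρ` may violate the lower bound, so `q = ρ + ε` on the ball of radius `2R` is
used and `ε → 0`. Testing the law of the combination against `log q` turns the double integral into
`∫ ρ log q`. -/
theorem EntropyIneq.entropyBound {E : Type*} [NormedAddCommGroup E] [NormedSpace ℝ E]
    [MeasureSpace E] [BorelSpace E] [SecondCountableTopology E] [ProperSpace E]
    [IsFiniteMeasureOnCompacts (volume : Measure E)] {c s : ℝ}
    (hE : EntropyIneq E c s) {f g ρ : E → ℝ} {R M : ℝ} (hR : 0 < R)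
    (hf : BddSupp f R M) (hg : BddSupp g R M) (hρ : BddSupp ρ (2 * R) M)
    (hcomb : IsCombDensity c s f g ρ) (hf0 : 0 < ∫ x, f x) (hg0 : 0 < ∫ x, g x) :
    EntropyBound c s f g ρ := by
  have hM : 0 ≤ M := (hf.nonneg 0).trans (hf.le 0)
  set K := Metric.closedBall (0 : E) (2 * R)
  have hKm : MeasurableSet K := Metric.isClosed_closedBall.measurableSet
  have hKfin : volume K < ⊤ := (isCompact_closedBall 0 _).measure_lt_top
  have hmass : ∫ x, ρ x = (∫ x, f x) * ∫ x, g x := by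
    have := hcomb (fun _ => 1) measurable_const ⟨1, by simp⟩
    simp only [one_mul] at this
    rw [this, Measure.volume_eq_prod, integral_prod_mul]
  have hε : ∀ ε : ℝ, 0 < ε → c ^ 2 * ((∫ x, negMulLog (f x)) * ∫ x, g x) +
      s ^ 2 * ((∫ x, f x) * ∫ x, negMulLog (g x)) ≤ (∫ x, negMulLog (ρ x)) +
      entropyKernel c s (∫ x, f x) (∫ x, g x) ((∫ x, f x) * (∫ x, g x) + ε * volume.real K) := by
    intro ε hε
    set q : E → ℝ := fun x => ρ x + K.indicator (fun _ => ε) x with hq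
    have hqK : ∀ x, ‖x‖ ≤ 2 * R → q x = ρ x + ε := fun x hx => by
      rw [hq]
      simp only
      rw [indicator_of_mem (by simpa [K] using hx)]
    have hqK' : ∀ x, 2 * R < ‖x‖ → q x = 0 := fun x hx => by
      rw [hq]
      simp only
      rw [indicator_of_notMem (by simpa [K] using hx), hρ.eq_zero x hx, add_zero]
    have hqm : Measurable q := hρ.measurable.add (measurable_const.indicator hKm)
    have hqB : BddSupp q (2 * R) (M + ε) := by
      refine ⟨hqm, fun x => ?_, fun x => ?_, hqK'⟩
      · exact add_nonneg (hρ.nonneg x) (indicator_nonneg (fun _ _ => hε.le) x)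
      · exact add_le_add (hρ.le x) (indicator_le_self' (fun _ _ => hε.le) x)
    have hMε : M ≤ M + ε := by linarith
    have hqε : ∀ x, ‖x‖ ≤ 2 * R → ε ≤ q x := fun x hx => by
      rw [hqK x hx]; linarith [hρ.nonneg x]
    have hmain := hE f g q R (M + ε) ε hR hε (hf.mono hMε) (hg.mono hMε) hqB hqε
    have hqint : ∫ x, q x = (∫ x, f x) * (∫ x, g x) + ε * volume.real K := by
      rw [hq, integral_add hρ.integrable ((integrable_indicator_iff hKm).2
        (integrableOn_const hKfin.ne)), hmass, integral_indicator hKm, setIntegral_const,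
        smul_eq_mul, mul_comm ε]
    rw [hqint] at hmain
    have hlogb : ∃ C, ∀ x, |log (q x)| ≤ C := by
      refine ⟨|log ε| + |log (M + ε)|, fun x => ?_⟩
      by_cases hx : ‖x‖ ≤ 2 * R
      · exact abs_log_le_of_mem hε (hqε x hx) (hqB.le x)
      · rw [hqK' x (not_le.1 hx), log_zero, abs_zero]
        positivity
    have hlogm : Measurable fun x => log (q x) := hqm.log
    have h1 := hcomb (fun x => log (q x)) hlogm hlogb
    obtain ⟨C, hC⟩ := hlogb
    have hi1 : Integrable fun p : E × E => f p.1 * g p.2 * log (q (c • p.1 + s • p.2)) := by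
      have hfg : Integrable fun p : E × E => f p.1 * g p.2 := hf.integrable.mul_prod hg.integrable
      exact hfg.mul_bdd (c := C) (hlogm.comp (by fun_prop :
        Measurable fun p : E × E => c • p.1 + s • p.2)).aestronglyMeasurable
        (Eventually.of_forall fun p => hC _)
    have hi2 : Integrable fun p : E × E => negMulLog (f p.1) * g p.2 :=
      hf.integrable_negMulLog.mul_prod hg.integrable
    have hi3 : Integrable fun p : E × E => f p.1 * negMulLog (g p.2) :=
      hf.integrable.mul_prod hg.integrable_negMulLog
    have hsplit : ∫ p : E × E, entropyKernel c s (f p.1) (g p.2) (q (c • p.1 + s • p.2)) =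
        (∫ z, log (q z) * ρ z) + c ^ 2 * ((∫ x, negMulLog (f x)) * ∫ x, g x) +
        s ^ 2 * ((∫ x, f x) * ∫ x, negMulLog (g x)) := by
      unfold entropyKernel
      have hi12 : Integrable fun p : E × E => f p.1 * g p.2 * log (q (c • p.1 + s • p.2)) +
          c ^ 2 * (negMulLog (f p.1) * g p.2) := hi1.add (hi2.const_mul _)
      rw [integral_add hi12 (hi3.const_mul _),
        integral_add hi1 (hi2.const_mul _), integral_const_mul, integral_const_mul, h1,
        Measure.volume_eq_prod, integral_prod_mul (fun x => negMulLog (f x)) g,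
        integral_prod_mul f (fun x => negMulLog (g x))]
      congr 3
      funext p
      ring
    -- Wherever `ρ > 0` the point lies in the ball, so `q = ρ + ε ≥ ρ` there.
    have hlow : -∫ x, negMulLog (ρ x) ≤ ∫ z, log (q z) * ρ z := by
      rw [← integral_neg]
      refine integral_mono hρ.integrable_negMulLog.neg
        (hρ.integrable.bdd_mul (c := C) hlogm.aestronglyMeasurable
          (Eventually.of_forall fun x => hC x)) fun x => ?_
      simp only [negMulLog, neg_mul, neg_neg]
      rcases (hρ.nonneg x).eq_or_lt with h0 | h0
      · simp [← h0]
      · have hx : ‖x‖ ≤ 2 * R := not_lt.1 fun hlt => h0.ne' (hρ.eq_zero x hlt)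
        rw [mul_comm, hqK x hx]
        exact mul_le_mul_of_nonneg_right (log_le_log h0 (by linarith)) h0.le
    linarith
  have hcont : Tendsto (fun ε : ℝ => (∫ x, negMulLog (ρ x)) + entropyKernel c s (∫ x, f x)
      (∫ x, g x) ((∫ x, f x) * (∫ x, g x) + ε * volume.real K)) (𝓝[>] 0)
      (𝓝 ((∫ x, negMulLog (ρ x)) + entropyKernel c s (∫ x, f x) (∫ x, g x)
        ((∫ x, f x) * ∫ x, g x))) := by
    have hpos : (∫ x, f x) * ∫ x, g x ≠ 0 := (mul_pos hf0 hg0).ne'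
    have h0 : Tendsto (fun ε : ℝ => (∫ x, f x) * (∫ x, g x) + ε * volume.real K) (𝓝[>] 0)
        (𝓝 ((∫ x, f x) * ∫ x, g x)) := by
      have : ContinuousAt (fun ε : ℝ => (∫ x, f x) * (∫ x, g x) + ε * volume.real K) 0 := by
        fun_prop
      simpa using this.tendsto.mono_left nhdsWithin_le_nhds
    unfold entropyKernel
    exact tendsto_const_nhds.add ((((h0.log hpos).const_mul _).add_const _).add_const _)
  refine ge_of_tendsto hcont ?_
  filter_upwards [self_mem_nhdsWithin] with ε h using hε ε h

/-- The conclusion involves no norm and the hypotheses use it only through supports. As the sup norm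
is at most the Euclidean one, supports stay in balls of the same radius, and no isometry is needed.
-/
theorem entropyBound_euclidean {c s : ℝ} (hc : 0 ≤ c) (hs : 0 ≤ s) (h : c ^ 2 + s ^ 2 = 1) {d : ℕ}
    {f g ρ : EuclideanSpace ℝ (Fin d) → ℝ} {R M : ℝ} (hR : 0 < R)
    (hf : BddSupp f R M) (hg : BddSupp g R M) (hρ : BddSupp ρ (2 * R) M)
    (hcomb : IsCombDensity c s f g ρ) (hf0 : 0 < ∫ x, f x) (hg0 : 0 < ∫ x, g x) :
    EntropyBound c s f g ρ := by
  set e := (MeasurableEquiv.toLp 2 (Fin d → ℝ))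
  have he : MeasurePreserving e := PiLp.volume_preserving_toLp (Fin d)
  have hnorm : ∀ x, ‖x‖ ≤ ‖e x‖ := fun x =>
    (pi_norm_le_iff_of_nonneg (norm_nonneg _)).2 fun i => PiLp.norm_apply_le (e x) i
  have htr : ∀ {u : EuclideanSpace ℝ (Fin d) → ℝ} {r : ℝ}, BddSupp u r M → BddSupp (u ∘ e) r M :=
    fun hu =>
      { measurable := hu.measurable.comp e.measurable
        nonneg := fun x => hu.nonneg _
        le := fun x => hu.le _
        eq_zero := fun x hx => hu.eq_zero _ (hx.trans_le (hnorm x)) }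
  have hint : ∀ u : EuclideanSpace ℝ (Fin d) → ℝ, ∫ x, u (e x) = ∫ x, u x := fun u =>
    he.integral_comp' u
  have hcomb' : IsCombDensity c s (f ∘ e) (g ∘ e) (ρ ∘ e) := by
    intro k hk ⟨C, hC⟩
    have h1 := hcomb (k ∘ e.symm) (hk.comp e.symm.measurable) ⟨C, fun x => hC _⟩
    rw [← hint, Measure.volume_eq_prod,
      ← (he.prod he).integral_comp (e.prodCongr e).measurableEmbedding] at h1
    simp only [Function.comp, e.symm_apply_apply, Prod.map_fst, Prod.map_snd] at h1
    exact h1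
  have := (entropyIneq_pi hc hs h d).entropyBound hR (htr hf) (htr hg) (htr hρ) hcomb'
    (by simpa [hint] using hf0) (by simpa [hint] using hg0)
  have e1 := hint fun x => negMulLog (f x)
  have e2 := hint fun x => negMulLog (g x)
  have e3 := hint fun x => negMulLog (ρ x)
  simpa only [EntropyBound, Function.comp, hint, e1, e2, e3] using this

end Truncated

/-! ### The density of a linear combination -/

section Comb

open Set Filter Topology Real Module

variable {E : Type*} [NormedAddCommGroup E] [NormedSpace ℝ E] [MeasureSpace E]

/-- The density of `c x + s y` when `x` and `y` are independent with densities `F` and `G`. -/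
noncomputable def combDensity (c s : ℝ) (F G : E → ENNReal) (z : E) : ENNReal :=
  ∫⁻ y, ENNReal.ofReal ((c ^ finrank ℝ E)⁻¹) * F (c⁻¹ • (z - s • y)) * G y

theorem combDensity_mono (c s : ℝ) {F F' G G' : E → ENNReal} (hF : ∀ x, F x ≤ F' x)
    (hG : ∀ x, G x ≤ G' x) (z : E) : combDensity c s F G z ≤ combDensity c s F' G' z :=
  lintegral_mono fun y => mul_le_mul' (mul_le_mul' le_rfl (hF _)) (hG y)

theorem tendsto_combDensity [BorelSpace E] (c s : ℝ) {F G : E → ENNReal} {Fn Gn : ℕ → E → ENNReal}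
    (hFn : ∀ n, Measurable (Fn n)) (hGn : ∀ n, Measurable (Gn n))
    (hFmono : ∀ x, Monotone fun n => Fn n x) (hGmono : ∀ x, Monotone fun n => Gn n x)
    (hFlim : ∀ x, ∀ᶠ n in atTop, Fn n x = F x) (hGlim : ∀ x, ∀ᶠ n in atTop, Gn n x = G x) (z : E) :
    Tendsto (fun n => combDensity c s (Fn n) (Gn n) z) atTop (𝓝 (combDensity c s F G z)) := by
  refine lintegral_tendsto_of_tendsto_of_monotone (fun n => ?_) ?_ ?_
  · have := hFn n
    have := hGn n
    exact Measurable.aemeasurable (by fun_prop)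
  · exact Eventually.of_forall fun y m n hmn =>
      mul_le_mul' (mul_le_mul' le_rfl (hFmono _ hmn)) (hGmono y hmn)
  · refine Eventually.of_forall fun y => ?_
    refine tendsto_const_nhds.congr' ?_
    filter_upwards [hFlim (c⁻¹ • (z - s • y)), hGlim y] with n h1 h2
    rw [h1, h2]

variable [BorelSpace E] [FiniteDimensional ℝ E] [(volume : Measure E).IsAddHaarMeasure]

theorem lintegral_comp_affine {c : ℝ} (hc : 0 < c) (v : E) {k : E → ENNReal} (hk : Measurable k) :
    ∫⁻ x, k (c • x + v) = ENNReal.ofReal ((c ^ finrank ℝ E)⁻¹) * ∫⁻ z, k z := by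
  have h1 : ∫⁻ x, k (c • x + v) = ∫⁻ z, k (z + v) ∂(Measure.map (c • ·) volume) := by
    rw [lintegral_map (by fun_prop) (by fun_prop)]
  rw [h1, Measure.map_addHaar_smul _ hc.ne', lintegral_smul_measure,
    lintegral_add_right_eq_self k v, smul_eq_mul, abs_of_pos (by positivity)]

theorem measurable_combDensity (c s : ℝ) {F G : E → ENNReal} (hF : Measurable F)
    (hG : Measurable G) : Measurable (combDensity c s F G) := by
  unfold combDensity
  have : Measurable (Function.uncurry fun (z y : E) =>
      ENNReal.ofReal ((c ^ finrank ℝ E)⁻¹) * F (c⁻¹ • (z - s • y)) * G y) := by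
    simp only [Function.uncurry_def]
    fun_prop
  exact this.lintegral_prod_right'

/-- For fixed `y`, substitute `z = c x + s y`, with Jacobian factor `c ^ (-d)`; then exchange the
integrals by Tonelli. -/
theorem lintegral_mul_combDensity {c : ℝ} (hc : 0 < c) (s : ℝ) {F G h : E → ENNReal}
    (hF : Measurable F) (hG : Measurable G) (hh : Measurable h) :
    ∫⁻ z, h z * combDensity c s F G z =
      ∫⁻ p : E × E, h (c • p.1 + s • p.2) * (F p.1 * G p.2) ∂(volume.prod volume) := by
  have hc' : c ≠ 0 := hc.ne'
  rw [lintegral_prod_symm _ (by fun_prop)]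
  have hinner : ∀ y, ∫⁻ x, h (c • x + s • y) * (F x * G y) =
      ∫⁻ z, h z * (ENNReal.ofReal ((c ^ finrank ℝ E)⁻¹) * F (c⁻¹ • (z - s • y)) * G y) := by
    intro y
    have := lintegral_comp_affine hc (s • y)
      (k := fun z => h z * (F (c⁻¹ • (z - s • y)) * G y)) (by fun_prop)
    simp only [add_sub_cancel_right, inv_smul_smul₀ hc'] at this
    rw [this, ← lintegral_const_mul _ (by fun_prop)]
    refine lintegral_congr fun z => ?_
    ring
  simp only [hinner]
  rw [lintegral_lintegral_swap (by
    simp only [Function.uncurry_def]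
    fun_prop)]
  refine lintegral_congr fun z => ?_
  rw [combDensity, lintegral_const_mul _ (by fun_prop)]

theorem map_withDensity_combination {c : ℝ} (hc : 0 < c) (s : ℝ) {F G : E → ENNReal}
    (hF : Measurable F) (hG : Measurable G) :
    ((volume.prod volume).withDensity fun p : E × E => F p.1 * G p.2).map
      (fun p => c • p.1 + s • p.2) = volume.withDensity (combDensity c s F G) := by
  ext A hA
  have hm : Measurable fun p : E × E => c • p.1 + s • p.2 := by fun_prop
  rw [Measure.map_apply hm hA, withDensity_apply _ (hm hA), withDensity_apply _ hA,
    ← lintegral_indicator hA, ← lintegral_indicator (hm hA)]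
  have := lintegral_mul_combDensity hc s hF hG (h := A.indicator 1) (measurable_one.indicator hA)
  convert! this.symm using 1
  · refine lintegral_congr fun p => ?_
    by_cases hp : c • p.1 + s • p.2 ∈ A
    · rw [indicator_of_mem (show p ∈ (fun p : E × E => c • p.1 + s • p.2) ⁻¹' A from hp),
        indicator_of_mem hp, Pi.one_apply, one_mul]
    · rw [indicator_of_notMem (show p ∉ (fun p : E × E => c • p.1 + s • p.2) ⁻¹' A from hp),
        indicator_of_notMem hp, zero_mul]
  · refine lintegral_congr fun z => ?_
    by_cases hz : z ∈ A
    · rw [indicator_of_mem hz, indicator_of_mem hz, Pi.one_apply, one_mul]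
    · rw [indicator_of_notMem hz, indicator_of_notMem hz, zero_mul]

theorem lintegral_combDensity {c : ℝ} (hc : 0 < c) (s : ℝ) {F G : E → ENNReal}
    (hF : Measurable F) (hG : Measurable G) :
    ∫⁻ z, combDensity c s F G z = (∫⁻ x, F x) * ∫⁻ y, G y := by
  have := lintegral_mul_combDensity hc s hF hG (h := 1) measurable_one
  simp only [Pi.one_apply, one_mul] at this
  rw [this, lintegral_prod_mul hF.aemeasurable hG.aemeasurable]

/-- The densities of bounded functions with bounded support combine to such a function. -/
theorem bddSupp_combDensity {c s : ℝ} (hc : 0 < c) (hc1 : |c| ≤ 1) (hs1 : |s| ≤ 1) {f g : E → ℝ}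
    {R M : ℝ} (hf : BddSupp f R M) (hg : BddSupp g R M)
    (hg1 : ∫⁻ x, ENNReal.ofReal (g x) ≤ 1) :
    BddSupp (fun z => (combDensity c s (fun x => ENNReal.ofReal (f x))
      (fun x => ENNReal.ofReal (g x)) z).toReal) (2 * R) ((c ^ finrank ℝ E)⁻¹ * M) := by
  have hM : 0 ≤ M := (hf.nonneg 0).trans (hf.le 0)
  have hfm := hf.measurable.ennreal_ofReal
  have hgm := hg.measurable.ennreal_ofReal
  refine ⟨(measurable_combDensity c s hfm hgm).ennreal_toReal, fun z => ENNReal.toReal_nonneg,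
    fun z => ?_, fun z hz => ?_⟩
  · refine ENNReal.toReal_le_of_le_ofReal (by positivity) ?_
    calc combDensity c s (fun x => ENNReal.ofReal (f x)) (fun x => ENNReal.ofReal (g x)) z
        ≤ ∫⁻ y, ENNReal.ofReal ((c ^ finrank ℝ E)⁻¹) * ENNReal.ofReal M * ENNReal.ofReal (g y) :=
          lintegral_mono fun y => mul_le_mul' (mul_le_mul' le_rfl
            (ENNReal.ofReal_le_ofReal (hf.le _))) le_rfl
      _ = ENNReal.ofReal ((c ^ finrank ℝ E)⁻¹) * ENNReal.ofReal M * ∫⁻ y, ENNReal.ofReal (g y) :=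
          lintegral_const_mul _ hgm
      _ ≤ ENNReal.ofReal ((c ^ finrank ℝ E)⁻¹) * ENNReal.ofReal M * 1 := by gcongr
      _ = ENNReal.ofReal ((c ^ finrank ℝ E)⁻¹ * M) := by
          rw [mul_one, ENNReal.ofReal_mul (by positivity)]
  · rw [combDensity]
    have : ∀ y, ENNReal.ofReal ((c ^ finrank ℝ E)⁻¹) *
        ENNReal.ofReal (f (c⁻¹ • (z - s • y))) * ENNReal.ofReal (g y) = 0 := by
      intro y
      by_cases hy : R < ‖y‖
      · simp [hg.eq_zero y hy]
      by_cases hx : R < ‖c⁻¹ • (z - s • y)‖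
      · simp [hf.eq_zero _ hx]
      exfalso
      have := norm_combination_le hc1 hs1 (not_lt.1 hx) (not_lt.1 hy)
      rw [smul_inv_smul₀ hc.ne', sub_add_cancel] at this
      linarith
    simp [this]

theorem isCombDensity_combDensity {c : ℝ} (hc : 0 < c) (s : ℝ) {f g : E → ℝ}
    (hf : Measurable f) (hg : Measurable g) (hf0 : ∀ x, 0 ≤ f x) (hg0 : ∀ x, 0 ≤ g x)
    (hfin : ∀ᵐ z, combDensity c s (fun x => ENNReal.ofReal (f x))
      (fun x => ENNReal.ofReal (g x)) z < ⊤) :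
    IsCombDensity c s f g fun z => (combDensity c s (fun x => ENNReal.ofReal (f x))
      (fun x => ENNReal.ofReal (g x)) z).toReal := by
  intro h hh _
  have hfm := hf.ennreal_ofReal
  have hgm := hg.ennreal_ofReal
  have hm : Measurable fun p : E × E => c • p.1 + s • p.2 := by fun_prop
  have h1 := integral_withDensity_eq_integral_toReal_smul (measurable_combDensity c s hfm hgm)
    hfin h
  rw [← map_withDensity_combination hc s hfm hgm,
    integral_map hm.aemeasurable hh.aestronglyMeasurable,
    integral_withDensity_eq_integral_toReal_smul (by fun_prop) (Eventually.of_forall fun p =>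
      ENNReal.mul_lt_top ENNReal.ofReal_lt_top ENNReal.ofReal_lt_top)] at h1
  simp only [smul_eq_mul, ENNReal.toReal_mul, ENNReal.toReal_ofReal (hf0 _),
    ENNReal.toReal_ofReal (hg0 _)] at h1
  rw [Measure.volume_eq_prod]
  simp only [mul_comm (h _)]
  exact h1.symm

end Comb

/-! ### Integrability of entropy parts, truncation and limits -/

section Limit

open Set Filter Topology Real Module

/-- The integral of the positive part of `-u log u`. -/
noncomputable def entropyPosPart {E : Type*} [MeasureSpace E] (u : E → ℝ) : ENNReal :=
  ∫⁻ x, ENNReal.ofReal (-(u x * log (u x)))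

/-- The integral of the negative part of `-u log u`. -/
noncomputable def entropyNegPart {E : Type*} [MeasureSpace E] (u : E → ℝ) : ENNReal :=
  ∫⁻ x, ENNReal.ofReal (u x * log (u x))

/-- The convex function `t log t` lies above its tangent at `r`: `k log k ≥ k log r + k - r`. Moving
`r` across leaves only nonnegative terms on the small side, so it survives in `ENNReal`. -/
theorem ofReal_mul_log_add_le {k r : ℝ} (hk : 0 ≤ k) (hr : 1 < r) :
    ENNReal.ofReal k * ENNReal.ofReal (log r) + ENNReal.ofReal k ≤
      ENNReal.ofReal (k * log k) + ENNReal.ofReal r := by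
  rw [← ENNReal.ofReal_mul hk, ← ENNReal.ofReal_add (mul_nonneg hk (log_nonneg hr.le)) hk]
  refine le_trans (ENNReal.ofReal_le_ofReal ?_) ENNReal.ofReal_add_le
  rcases hk.eq_or_lt with h | h
  · simp only [← h, zero_mul, zero_add]
    linarith
  have hr0 : 0 < r := by linarith
  have h1 := log_le_sub_one_of_pos (div_pos hr0 h)
  rw [log_div hr0.ne' h.ne'] at h1
  have h2 := mul_le_mul_of_nonneg_left h1 h.le
  rw [mul_sub, mul_sub, mul_div_cancel₀ _ h.ne'] at h2
  linarith

/-- From `u log (v/u) ≤ v - u`, split by the sign of `log v`. It provides the dominating function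
for the positive part of the entropy of truncations. -/
theorem ofReal_neg_mul_log_le {u v : ℝ} (hu : 0 ≤ u) (huv : u ≤ v) :
    ENNReal.ofReal (-(u * log u)) ≤ ENNReal.ofReal (-(v * log v)) + ENNReal.ofReal v := by
  rcases hu.eq_or_lt with h | h
  · simp [← h]
  have hv : 0 < v := h.trans_le huv
  have h1 := log_le_sub_one_of_pos (div_pos hv h)
  rw [log_div hv.ne' h.ne'] at h1
  have h2 := mul_le_mul_of_nonneg_left h1 h.le
  rw [mul_sub, mul_sub, mul_div_cancel₀ _ h.ne'] at h2
  rcases le_total (log v) 0 with hl | hl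
  · have h3 := mul_le_mul_of_nonpos_right huv hl
    rw [← ENNReal.ofReal_add (by nlinarith) hv.le]
    exact ENNReal.ofReal_le_ofReal (by linarith)
  · refine le_trans (ENNReal.ofReal_le_ofReal ?_) le_add_self
    have := mul_nonneg h.le hl
    linarith

section Jensen

variable {E : Type*} [NormedAddCommGroup E] [NormedSpace ℝ E] [MeasureSpace E] [BorelSpace E]

/-- Jensen for `t log t` against the probability density `G`: integrate the tangent inequality at
`r`, the mean itself, and cancel the finite value `D`. Values `r ≤ 1` contribute nothing. -/
theorem ofReal_combDensity_mul_log_le {c : ℝ} (hc : 0 < c) (s : ℝ) {f : E → ℝ}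
    {G : E → ENNReal} (hf : Measurable f) (hG : Measurable G) (hf0 : ∀ x, 0 ≤ f x)
    (hG1 : ∫⁻ x, G x = 1) {z : E}
    (hz : combDensity c s (fun x => ENNReal.ofReal (f x)) G z ≠ ⊤) :
    ENNReal.ofReal ((combDensity c s (fun x => ENNReal.ofReal (f x)) G z).toReal *
      log (combDensity c s (fun x => ENNReal.ofReal (f x)) G z).toReal) ≤
    combDensity c s (fun x => ENNReal.ofReal (f x * log ((c ^ finrank ℝ E)⁻¹ * f x))) G z := by
  set D := combDensity c s (fun x => ENNReal.ofReal (f x)) G z with hD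
  set r := D.toReal
  set l := (c ^ finrank ℝ E)⁻¹ with hl
  have hl0 : 0 < l := by positivity
  have hr0 : 0 ≤ r := ENNReal.toReal_nonneg
  by_cases hr : r ≤ 1
  · rw [ENNReal.ofReal_of_nonpos (mul_nonpos_of_nonneg_of_nonpos hr0 (log_nonpos hr0 hr))]
    exact zero_le
  rw [not_le] at hr
  have hDr : ENNReal.ofReal r = D := ENNReal.ofReal_toReal hz
  rw [ENNReal.ofReal_mul hr0, hDr]
  refine (ENNReal.add_le_add_iff_right hz).1 ?_
  have hfm : Measurable fun y => f (c⁻¹ • (z - s • y)) := hf.comp (by fun_prop)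
  calc D * ENNReal.ofReal (log r) + D
      = ∫⁻ y, (ENNReal.ofReal (l * f (c⁻¹ • (z - s • y))) * ENNReal.ofReal (log r) +
          ENNReal.ofReal (l * f (c⁻¹ • (z - s • y)))) * G y := by
        have hm : Measurable fun y => ENNReal.ofReal (l * f (c⁻¹ • (z - s • y))) * G y := by
          fun_prop
        have hD' : D = ∫⁻ y, ENNReal.ofReal (l * f (c⁻¹ • (z - s • y))) * G y := by
          rw [hD, combDensity]
          refine lintegral_congr fun y => ?_
          rw [← hl, ENNReal.ofReal_mul hl0.le]
        nth_rewrite 1 2 [hD']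
        rw [← lintegral_mul_const _ hm, ← lintegral_add_right _ hm]
        refine lintegral_congr fun y => ?_
        ring
    _ ≤ ∫⁻ y, (ENNReal.ofReal (l * f (c⁻¹ • (z - s • y)) * log (l * f (c⁻¹ • (z - s • y)))) +
          ENNReal.ofReal r) * G y :=
        lintegral_mono fun y => mul_le_mul_left
          (ofReal_mul_log_add_le (mul_nonneg hl0.le (hf0 _)) hr) _
    _ = combDensity c s (fun x => ENNReal.ofReal (f x * log (l * f x))) G z + D := by
        simp only [add_mul]
        rw [lintegral_add_right _ (by fun_prop), lintegral_const_mul _ hG, hG1, mul_one, hDr]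
        congr 1
        rw [combDensity]
        refine lintegral_congr fun y => ?_
        rw [← hl, ← ENNReal.ofReal_mul hl0.le, mul_assoc]

/-- Integrating the Jensen bound over `z` removes `G`; the factor `c ^ (-d)` inside the logarithm
costs at most `|log l|`, since `f` has mass one. -/
theorem entropyNegPart_combDensity_lt_top [FiniteDimensional ℝ E]
    [(volume : Measure E).IsAddHaarMeasure] {c : ℝ} (hc : 0 < c) (s : ℝ) {f : E → ℝ}
    {G : E → ENNReal} (hf : Measurable f) (hG : Measurable G) (hf0 : ∀ x, 0 ≤ f x)
    (hf1 : ∫⁻ x, ENNReal.ofReal (f x) = 1) (hG1 : ∫⁻ x, G x = 1)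
    (hB : entropyNegPart f ≠ ⊤)
    (hfin : ∀ᵐ z, combDensity c s (fun x => ENNReal.ofReal (f x)) G z < ⊤) :
    entropyNegPart (fun z => (combDensity c s (fun x => ENNReal.ofReal (f x)) G z).toReal)
      < ⊤ := by
  set l := (c ^ finrank ℝ E)⁻¹ with hl
  have hl0 : 0 < l := by positivity
  have hΦ : Measurable fun x => ENNReal.ofReal (f x * log (l * f x)) := by fun_prop
  have hbound : ∫⁻ x, ENNReal.ofReal (f x * log (l * f x)) < ⊤ := by
    calc ∫⁻ x, ENNReal.ofReal (f x * log (l * f x))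
        ≤ ∫⁻ x, (ENNReal.ofReal (f x * log (f x)) +
            ENNReal.ofReal (f x) * ENNReal.ofReal |log l|) := by
          refine lintegral_mono fun x => ?_
          rw [← ENNReal.ofReal_mul (hf0 x)]
          refine le_trans (ENNReal.ofReal_le_ofReal ?_) ENNReal.ofReal_add_le
          rcases (hf0 x).eq_or_lt with h | h
          · simp [← h]
          · rw [log_mul hl0.ne' h.ne', mul_add, add_comm]
            have := mul_le_mul_of_nonneg_left (le_abs_self (log l)) h.le
            linarith
      _ = entropyNegPart f + ENNReal.ofReal |log l| := by
          rw [lintegral_add_right _ (by fun_prop), lintegral_mul_const _ hf.ennreal_ofReal, hf1,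
            one_mul, entropyNegPart]
      _ < ⊤ := ENNReal.add_lt_top.2 ⟨hB.lt_top, ENNReal.ofReal_lt_top⟩
  calc entropyNegPart (fun z => (combDensity c s (fun x => ENNReal.ofReal (f x)) G z).toReal)
      ≤ ∫⁻ z, combDensity c s (fun x => ENNReal.ofReal (f x * log (l * f x))) G z := by
        refine lintegral_mono_ae ?_
        filter_upwards [hfin] with z hz
        exact ofReal_combDensity_mul_log_le hc s hf hG hf0 hG1 hz.ne
    _ < ⊤ := by rwa [lintegral_combDensity hc s hΦ hG, hG1, mul_one]

end Jensen

section Truncation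

variable {E : Type*} [NormedAddCommGroup E]

/-- The restriction of `f` to the set where `‖x‖ ≤ n` and `f x ≤ n`. -/
noncomputable def truncFun (f : E → ℝ) (n : ℕ) : E → ℝ :=
  {x | ‖x‖ ≤ n ∧ f x ≤ n}.indicator f

theorem truncFun_eventually_eq (f : E → ℝ) (x : E) : ∀ᶠ n in atTop, truncFun f n x = f x := by
  filter_upwards [eventually_ge_atTop ⌈max ‖x‖ (f x)⌉₊] with n hn
  have := Nat.ceil_le.1 hn
  exact indicator_of_mem (show x ∈ {x | ‖x‖ ≤ n ∧ f x ≤ n} from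
    ⟨(le_max_left _ _).trans this, (le_max_right _ _).trans this⟩) f

theorem truncFun_set_mono (f : E → ℝ) : Monotone fun n : ℕ => {x | ‖x‖ ≤ n ∧ f x ≤ n} :=
  fun m n hmn x hx => by
    have : (m : ℝ) ≤ n := Nat.cast_le.2 hmn
    exact ⟨hx.1.trans this, hx.2.trans this⟩

/-- Truncation restricts `f` to growing sets instead of capping its values, so `φ` need not be
monotone. This covers both parts of `-t log t`. -/
theorem comp_truncFun_mono {f : E → ℝ} {φ : ℝ → ENNReal} (hφ0 : φ 0 = 0) (x : E) :
    Monotone fun n => φ (truncFun f n x) := by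
  intro m n hmn
  by_cases hx : x ∈ {x | ‖x‖ ≤ (m : ℝ) ∧ f x ≤ m}
  · simp only [truncFun]
    rw [indicator_of_mem hx, indicator_of_mem (truncFun_set_mono f hmn hx)]
  · simp only [truncFun]
    rw [indicator_of_notMem hx, hφ0]
    exact zero_le

variable [MeasureSpace E] [OpensMeasurableSpace E]

theorem measurableSet_truncFun {f : E → ℝ} (hf : Measurable f) (n : ℕ) :
    MeasurableSet {x | ‖x‖ ≤ (n : ℝ) ∧ f x ≤ n} :=
  (measurableSet_le measurable_norm measurable_const).inter (measurableSet_le hf measurable_const)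

theorem bddSupp_truncFun {f : E → ℝ} (hf : Measurable f) (hf0 : ∀ x, 0 ≤ f x) (n : ℕ) :
    BddSupp (truncFun f n) (n + 1) (n + 1) where
  measurable := hf.indicator (measurableSet_truncFun hf n)
  nonneg x := indicator_nonneg (fun x _ => hf0 x) x
  le x := by
    by_cases hx : x ∈ {x | ‖x‖ ≤ (n : ℝ) ∧ f x ≤ n}
    · rw [truncFun, indicator_of_mem hx]
      linarith [hx.2]
    · rw [truncFun, indicator_of_notMem hx]
      positivity
  eq_zero x hx := indicator_of_notMem (fun h => by
    have : ‖x‖ ≤ (n : ℝ) := h.1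
    linarith) f

theorem tendsto_lintegral_comp_truncFun {f : E → ℝ} (hf : Measurable f) {φ : ℝ → ENNReal}
    (hφ : Measurable φ) (hφ0 : φ 0 = 0) :
    Tendsto (fun n => ∫⁻ x, φ (truncFun f n x)) atTop (𝓝 (∫⁻ x, φ (f x))) := by
  refine lintegral_tendsto_of_tendsto_of_monotone (fun n => ?_)
    (Eventually.of_forall (comp_truncFun_mono hφ0)) (Eventually.of_forall fun x => ?_)
  · exact (hφ.comp (hf.indicator (measurableSet_truncFun hf n))).aemeasurable
  · refine tendsto_const_nhds.congr' ?_
    filter_upwards [truncFun_eventually_eq f x] with n hn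
    rw [hn]

theorem tendsto_integral_truncFun {f : E → ℝ} (hf : Measurable f) (hf0 : ∀ x, 0 ≤ f x)
    (hf1 : ∫⁻ x, ENNReal.ofReal (f x) = 1) :
    Tendsto (fun n => ∫ x, truncFun f n x) atTop (𝓝 1) := by
  have h := tendsto_lintegral_comp_truncFun hf (φ := ENNReal.ofReal) ENNReal.measurable_ofReal
    ENNReal.ofReal_zero
  rw [hf1] at h
  have h2 := (ENNReal.tendsto_toReal ENNReal.one_ne_top).comp h
  rw [ENNReal.toReal_one] at h2
  refine h2.congr fun n => ?_
  have hb := bddSupp_truncFun hf hf0 n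
  exact (integral_eq_lintegral_of_nonneg_ae (Eventually.of_forall hb.nonneg)
    hb.measurable.aestronglyMeasurable).symm

end Truncation

section BddEntropy

variable {E : Type*} [NormedAddCommGroup E] [MeasureSpace E] [ProperSpace E]
  [IsFiniteMeasureOnCompacts (volume : Measure E)] {u : E → ℝ} {R M : ℝ}

theorem BddSupp.entropyPosPart_ne_top (hu : BddSupp u R M) : entropyPosPart u ≠ ⊤ := by
  have := hu.integrable_negMulLog.lintegral_lt_top
  simpa [entropyPosPart, negMulLog] using this.ne

theorem BddSupp.entropyNegPart_ne_top (hu : BddSupp u R M) : entropyNegPart u ≠ ⊤ := by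
  have := hu.integrable_negMulLog.neg.lintegral_lt_top
  simpa [entropyNegPart, negMulLog] using this.ne

theorem BddSupp.integral_negMulLog (hu : BddSupp u R M) :
    ∫ x, negMulLog (u x) = (entropyPosPart u).toReal - (entropyNegPart u).toReal := by
  rw [integral_eq_lintegral_pos_part_sub_lintegral_neg_part hu.integrable_negMulLog]
  simp [entropyPosPart, entropyNegPart, negMulLog]

end BddEntropy

/-- The two parts converge separately by monotone convergence, and subtraction in `EReal` is
continuous at the limit because the negative part is finite. -/
theorem tendsto_coe_integral_negMulLog_truncFun {E : Type*} [NormedAddCommGroup E]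
    [MeasureSpace E] [OpensMeasurableSpace E] [ProperSpace E]
    [IsFiniteMeasureOnCompacts (volume : Measure E)] {f : E → ℝ}
    (hf : Measurable f) (hf0 : ∀ x, 0 ≤ f x) (hB : entropyNegPart f ≠ ⊤) :
    Tendsto (fun n => ((∫ x, negMulLog (truncFun f n x) : ℝ) : EReal)) atTop
      (𝓝 ((entropyPosPart f : EReal) - (entropyNegPart f : EReal))) := by
  have hA := tendsto_lintegral_comp_truncFun hf (φ := fun t => ENNReal.ofReal (-(t * log t)))
    (by fun_prop) (by simp)
  have hBn := tendsto_lintegral_comp_truncFun hf (φ := fun t => ENNReal.ofReal (t * log t))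
    (by fun_prop) (by simp)
  have hA' := EReal.tendsto_coe_ennreal.2 hA
  have hB' := (EReal.tendsto_coe_ennreal.2 hBn).neg
  have hadd : ContinuousAt (fun p : EReal × EReal => p.1 + p.2)
      ((entropyPosPart f : EReal), -(entropyNegPart f : EReal)) := by
    refine EReal.continuousAt_add (Or.inr ?_) (Or.inl (EReal.coe_ennreal_ne_bot _))
    simpa [EReal.neg_eq_bot_iff] using hB
  have h := hadd.tendsto.comp (hA'.prodMk_nhds hB')
  refine h.congr fun n => ?_
  have hb := bddSupp_truncFun hf hf0 n
  rw [hb.integral_negMulLog, EReal.coe_sub, EReal.coe_ennreal_toReal hb.entropyPosPart_ne_top,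
    EReal.coe_ennreal_toReal hb.entropyNegPart_ne_top]
  rfl

/-- Since `Ln ≤ An` eventually and `A` is finite, `L = ⊤` is impossible; for real `L`, the bound `Bn
≤ An - Ln` passes to the lower limit and also shows that `B` is finite. -/
theorem le_sub_of_tendsto {A B : ENNReal} {An Bn : ℕ → ENNReal} {Ln : ℕ → ℝ} {L : EReal}
    (hA : Tendsto An atTop (𝓝 A)) (hAtop : A ≠ ⊤) (hB : B ≤ liminf Bn atTop)
    (hBn : ∀ n, Bn n ≠ ⊤) (hL : Tendsto (fun n => (Ln n : EReal)) atTop (𝓝 L))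
    (hle : ∀ᶠ n in atTop, Ln n ≤ (An n).toReal - (Bn n).toReal) :
    L ≤ (A : EReal) - (B : EReal) := by
  have hA' : Tendsto (fun n => (An n).toReal) atTop (𝓝 A.toReal) :=
    (ENNReal.tendsto_toReal hAtop).comp hA
  induction L with
  | bot => exact bot_le
  | top =>
    rw [EReal.tendsto_coe_nhds_top_iff] at hL
    exfalso
    have h1 := hA'.eventually (gt_mem_nhds (lt_add_one A.toReal))
    have h2 := hL.eventually (eventually_ge_atTop (A.toReal + 1))
    obtain ⟨n, ⟨h1, h2⟩, h3⟩ := ((h1.and h2).and hle).exists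
    have := ENNReal.toReal_nonneg (a := Bn n)
    linarith
  | coe l =>
    rw [EReal.tendsto_coe] at hL
    have hsub := hA'.sub hL
    have h0 : 0 ≤ A.toReal - l := ge_of_tendsto hsub <| by
      filter_upwards [hle] with n hn
      linarith [ENNReal.toReal_nonneg (a := Bn n)]
    have h1 : B ≤ ENNReal.ofReal (A.toReal - l) := by
      refine hB.trans ?_
      rw [← (ENNReal.tendsto_ofReal hsub).liminf_eq]
      refine liminf_le_liminf ?_
      filter_upwards [hle] with n hn
      rw [← ENNReal.ofReal_toReal (hBn n)]
      exact ENNReal.ofReal_le_ofReal (by linarith)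
    have hBtop : B ≠ ⊤ := ne_top_of_le_ne_top ENNReal.ofReal_ne_top h1
    have h2 : B.toReal ≤ A.toReal - l := ENNReal.toReal_le_of_le_ofReal h0 h1
    rw [← EReal.coe_ennreal_toReal hAtop, ← EReal.coe_ennreal_toReal hBtop, ← EReal.coe_sub,
      EReal.coe_le_coe_iff]
    linarith

end Limit

/-! ### The inequality for general densities and for random vectors -/

section Main

open Set Filter Topology Real Module

/-- Shannon's inequality for densities. -/
theorem entropy_combDensity_ge {c s : ℝ} (hc : 0 < c) (hs : 0 < s) (h : c ^ 2 + s ^ 2 = 1) {d : ℕ}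
    {f g : EuclideanSpace ℝ (Fin d) → ℝ} (hf : Measurable f) (hg : Measurable g)
    (hf0 : ∀ x, 0 ≤ f x) (hg0 : ∀ x, 0 ≤ g x) (hf1 : ∫⁻ x, ENNReal.ofReal (f x) = 1)
    (hg1 : ∫⁻ x, ENNReal.ofReal (g x) = 1) (hBf : entropyNegPart f ≠ ⊤)
    (hBg : entropyNegPart g ≠ ⊤) {r : EuclideanSpace ℝ (Fin d) → ℝ}
    (hr : r = fun z => (combDensity c s (fun x => ENNReal.ofReal (f x))
      (fun x => ENNReal.ofReal (g x)) z).toReal) :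
    ((c ^ 2 : ℝ) : EReal) * ((entropyPosPart f : EReal) - (entropyNegPart f : EReal)) +
      ((s ^ 2 : ℝ) : EReal) * ((entropyPosPart g : EReal) - (entropyNegPart g : EReal)) ≤
      (entropyPosPart r : EReal) - (entropyNegPart r : EReal) := by
  have hc1 : |c| ≤ 1 := abs_le_one_iff_mul_self_le_one.2 (by nlinarith)
  have hs1 : |s| ≤ 1 := abs_le_one_iff_mul_self_le_one.2 (by nlinarith)
  set D := combDensity c s (fun x => ENNReal.ofReal (f x)) (fun x => ENNReal.ofReal (g x)) with hD
  have hDm : Measurable D := measurable_combDensity c s hf.ennreal_ofReal hg.ennreal_ofReal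
  have hD1 : ∫⁻ z, D z = 1 := by
    rw [lintegral_combDensity hc s hf.ennreal_ofReal hg.ennreal_ofReal, hf1, hg1, mul_one]
  have hDfin : ∀ᵐ z, D z < ⊤ := ae_lt_top hDm (by rw [hD1]; exact ENNReal.one_ne_top)
  have hBr : entropyNegPart r < ⊤ := by
    rw [hr]
    exact entropyNegPart_combDensity_lt_top hc s hf hg.ennreal_ofReal hf0 hf1 hg1 hBf hDfin
  -- With finite negative part, an infinite positive part makes the right side `⊤`, not `⊤ - ⊤ = ⊥`.
  by_cases hAr : entropyPosPart r = ⊤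
  · rw [hAr, EReal.coe_ennreal_top, EReal.top_sub (by simpa using hBr.ne)]
    exact le_top
  -- the truncated densities
  set fn := truncFun f
  set gn := truncFun g
  have hfn := bddSupp_truncFun hf hf0
  have hgn := bddSupp_truncFun hg hg0
  set Dn : ℕ → EuclideanSpace ℝ (Fin d) → ENNReal := fun n =>
    combDensity c s (fun x => ENNReal.ofReal (fn n x)) (fun x => ENNReal.ofReal (gn n x)) with hDn
  set rn : ℕ → EuclideanSpace ℝ (Fin d) → ℝ := fun n z => (Dn n z).toReal with hrn
  have hDlim : ∀ z, Tendsto (fun n => Dn n z) atTop (𝓝 (D z)) := fun z =>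
    tendsto_combDensity c s (fun n => (hfn n).measurable.ennreal_ofReal)
      (fun n => (hgn n).measurable.ennreal_ofReal)
      (comp_truncFun_mono ENNReal.ofReal_zero) (comp_truncFun_mono ENNReal.ofReal_zero)
      (fun x => (truncFun_eventually_eq f x).mono fun n hn => by rw [hn])
      (fun x => (truncFun_eventually_eq g x).mono fun n hn => by rw [hn]) z
  have htle : ∀ (u : EuclideanSpace ℝ (Fin d) → ℝ), (∀ x, 0 ≤ u x) → ∀ n x,
      ENNReal.ofReal (truncFun u n x) ≤ ENNReal.ofReal (u x) := fun u hu n x =>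
    ENNReal.ofReal_le_ofReal (indicator_le_self' (fun x _ => hu x) x)
  have hDle : ∀ n z, Dn n z ≤ D z := fun n z =>
    combDensity_mono c s (htle f hf0 n) (htle g hg0 n) z
  have hgn1 : ∀ n, ∫⁻ x, ENNReal.ofReal (gn n x) ≤ 1 := fun n =>
    (lintegral_mono (htle g hg0 n)).trans hg1.le
  have hrnB : ∀ n, BddSupp (rn n) (2 * ((n : ℝ) + 1)) ((c ^ finrank ℝ
      (EuclideanSpace ℝ (Fin d)))⁻¹ * ((n : ℝ) + 1)) := fun n =>
    bddSupp_combDensity hc hc1 hs1 (hfn n) (hgn n) (hgn1 n)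
  have hrnlim : ∀ᵐ z, Tendsto (fun n => rn n z) atTop (𝓝 (r z)) := by
    filter_upwards [hDfin] with z hz
    rw [hr]
    exact (ENNReal.tendsto_toReal hz.ne).comp (hDlim z)
  have hrnle : ∀ᵐ z, ∀ n, rn n z ≤ r z := by
    filter_upwards [hDfin] with z hz n
    rw [hr]
    exact ENNReal.toReal_mono hz.ne (hDle n z)
  have hrm : Measurable r := by rw [hr]; exact hDm.ennreal_toReal
  have hr1 : ∫⁻ z, ENNReal.ofReal (r z) = 1 := by
    rw [← hD1, hr]
    refine lintegral_congr_ae ?_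
    filter_upwards [hDfin] with z hz
    exact ENNReal.ofReal_toReal hz.ne
  -- the limits of the two parts of the entropy
  have hAlim : Tendsto (fun n => entropyPosPart (rn n)) atTop (𝓝 (entropyPosPart r)) := by
    refine tendsto_lintegral_of_dominated_convergence
      (fun z => ENNReal.ofReal (-(r z * log (r z))) + ENNReal.ofReal (r z)) (fun n => ?_)
      (fun n => ?_) ?_ ?_
    · have := (hrnB n).measurable
      fun_prop
    · filter_upwards [hrnle] with z hz
      exact ofReal_neg_mul_log_le ((hrnB n).nonneg z) (hz n)
    · rw [lintegral_add_right _ hrm.ennreal_ofReal, hr1]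
      exact ENNReal.add_ne_top.2 ⟨hAr, ENNReal.one_ne_top⟩
    · filter_upwards [hrnlim] with z hz
      exact ENNReal.tendsto_ofReal ((continuous_mul_log.tendsto _).comp hz).neg
  have hBlim : entropyNegPart r ≤ liminf (fun n => entropyNegPart (rn n)) atTop := by
    calc entropyNegPart r
        = ∫⁻ z, liminf (fun n => ENNReal.ofReal (rn n z * log (rn n z))) atTop := by
          refine lintegral_congr_ae ?_
          filter_upwards [hrnlim] with z hz
          exact (ENNReal.tendsto_ofReal
            ((continuous_mul_log.tendsto _).comp hz)).liminf_eq.symm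
      _ ≤ liminf (fun n => entropyNegPart (rn n)) atTop := by
          refine lintegral_liminf_le fun n => ?_
          have := (hrnB n).measurable
          fun_prop
  -- the lower bound
  have ha := tendsto_integral_truncFun hf hf0 hf1
  have hb := tendsto_integral_truncFun hg hg0 hg1
  -- Truncations have masses below one in general; the kernel term is the resulting error, which
  -- tends to zero as the masses tend to one.
  set L : ℕ → ℝ := fun n => c ^ 2 * (∫ x, gn n x) * (∫ x, negMulLog (fn n x)) +
    s ^ 2 * (∫ x, fn n x) * (∫ x, negMulLog (gn n x)) -
      entropyKernel c s (∫ x, fn n x) (∫ x, gn n x) ((∫ x, fn n x) * ∫ x, gn n x) with hL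
  have hle : ∀ᶠ n in atTop, L n ≤ (entropyPosPart (rn n)).toReal -
      (entropyNegPart (rn n)).toReal := by
    filter_upwards [ha.eventually (lt_mem_nhds one_pos), hb.eventually (lt_mem_nhds one_pos)]
      with n han hbn
    rw [← (hrnB n).integral_negMulLog]
    have hfinn : ∀ᵐ z, Dn n z < ⊤ := hDfin.mono fun z hz => (hDle n z).trans_lt hz
    set M := max ((n : ℝ) + 1)
      ((c ^ finrank ℝ (EuclideanSpace ℝ (Fin d)))⁻¹ * ((n : ℝ) + 1))
    have hbound := entropyBound_euclidean hc.le hs.le h (by positivity : (0 : ℝ) < n + 1)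
      ((hfn n).mono (le_max_left _ _ : _ ≤ M)) ((hgn n).mono (le_max_left _ _))
      ((hrnB n).mono (le_max_right _ _))
      (isCombDensity_combDensity hc s (hfn n).measurable (hgn n).measurable (hfn n).nonneg
        (hgn n).nonneg hfinn) han hbn
    rw [EntropyBound] at hbound
    simp only [hL]
    linarith
  have hmul : ∀ {a : ℝ} {u : ℕ → ℝ} {v : ℕ → ℝ} {V : EReal}, 0 < a → Tendsto u atTop (𝓝 a) →
      Tendsto (fun n => (v n : EReal)) atTop (𝓝 V) →
      Tendsto (fun n => ((u n * v n : ℝ) : EReal)) atTop (𝓝 ((a : EReal) * V)) := by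
    intro a u v V ha hu hv
    have ha' : (a : EReal) ≠ 0 := by simpa using ha.ne'
    have hcont : ContinuousAt (fun p : EReal × EReal => p.1 * p.2) ((a : EReal), V) :=
      EReal.continuousAt_mul (Or.inl ha') (Or.inl ha') (Or.inl (EReal.coe_ne_bot a))
        (Or.inl (EReal.coe_ne_top a))
    exact (hcont.tendsto.comp ((EReal.tendsto_coe.2 hu).prodMk_nhds hv)).congr fun n => by simp
  have hLf := hmul (pow_pos hc 2) (by simpa using hb.const_mul (c ^ 2))
    (tendsto_coe_integral_negMulLog_truncFun hf hf0 hBf)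
  have hLg := hmul (pow_pos hs 2) (by simpa using ha.const_mul (s ^ 2))
    (tendsto_coe_integral_negMulLog_truncFun hg hg0 hBg)
  -- Neither summand of the limit is `⊥`, so addition in `EReal` is continuous there.
  have hne : ∀ (a : ℝ) (u : EuclideanSpace ℝ (Fin d) → ℝ), 0 < a → entropyNegPart u ≠ ⊤ →
      (a : EReal) * ((entropyPosPart u : EReal) - (entropyNegPart u : EReal)) ≠ ⊥ := by
    intro a u ha hu
    rw [← EReal.coe_ennreal_toReal hu]
    by_cases hp : entropyPosPart u = ⊤
    · rw [hp, EReal.coe_ennreal_top, EReal.top_sub_coe, EReal.coe_mul_top_of_pos ha]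
      exact top_ne_bot
    · rw [← EReal.coe_ennreal_toReal hp, ← EReal.coe_sub, ← EReal.coe_mul]
      exact EReal.coe_ne_bot _
  have hK : Tendsto (fun n => -entropyKernel c s (∫ x, fn n x) (∫ x, gn n x)
      ((∫ x, fn n x) * ∫ x, gn n x)) atTop (𝓝 0) := by
    have hnl : Tendsto negMulLog (𝓝 1) (𝓝 0) := by
      simpa using continuous_negMulLog.tendsto 1
    have hab := ha.mul hb
    have h1 := (hab.mul (hab.log (by simp))).add ((((hnl.comp ha).mul hb).const_mul (c ^ 2)))
    have h2 := (h1.add ((ha.mul (hnl.comp hb)).const_mul (s ^ 2))).neg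
    simpa [entropyKernel] using h2
  have hadd : ∀ {u v : ℕ → ℝ} {U V : EReal}, U ≠ ⊥ → V ≠ ⊥ →
      Tendsto (fun n => (u n : EReal)) atTop (𝓝 U) → Tendsto (fun n => (v n : EReal)) atTop (𝓝 V) →
      Tendsto (fun n => ((u n + v n : ℝ) : EReal)) atTop (𝓝 (U + V)) := by
    intro u v U V hU hV hu hv
    have hcont : ContinuousAt (fun p : EReal × EReal => p.1 + p.2) (U, V) :=
      EReal.continuousAt_add (Or.inr hV) (Or.inl hU)
    exact (hcont.tendsto.comp (hu.prodMk_nhds hv)).congr fun n => by simp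
  have hU := hne _ f (pow_pos hc 2) hBf
  have hV := hne _ g (pow_pos hs 2) hBg
  have hsum := hadd hU hV hLf hLg
  have hLlim := hadd (by rw [Ne, EReal.add_eq_bot_iff]; exact not_or.2 ⟨hU, hV⟩)
    (EReal.coe_ne_bot 0) hsum (EReal.tendsto_coe.2 hK)
  rw [EReal.coe_zero, add_zero] at hLlim
  exact le_sub_of_tendsto hAlim hAr hBlim (fun n => (hrnB n).entropyNegPart_ne_top)
    (hLlim.congr fun n => by rw [hL]; rfl) hle

variable {d : ℕ}

theorem measurable_lebesgueDensity (μ : Measure (EuclideanSpace ℝ (Fin d))) :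
    Measurable (lebesgueDensity μ) := (Measure.measurable_rnDeriv _ _).ennreal_toReal

theorem withDensity_lebesgueDensity {μ : Measure (EuclideanSpace ℝ (Fin d))}
    [IsFiniteMeasure μ] (hμ : μ ≪ volume) :
    volume.withDensity (fun x => ENNReal.ofReal (lebesgueDensity μ x)) = μ := by
  nth_rewrite 2 [← Measure.withDensity_rnDeriv_eq μ volume hμ]
  refine withDensity_congr_ae ?_
  filter_upwards [Measure.rnDeriv_lt_top μ volume] with x hx
  exact ENNReal.ofReal_toReal hx.ne

theorem lintegral_lebesgueDensity {μ : Measure (EuclideanSpace ℝ (Fin d))}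
    [IsProbabilityMeasure μ] (hμ : μ ≪ volume) :
    ∫⁻ x, ENNReal.ofReal (lebesgueDensity μ x) = 1 := by
  rw [← setLIntegral_univ, ← withDensity_apply _ MeasurableSet.univ,
    withDensity_lebesgueDensity hμ, measure_univ]

theorem shannonEntropy_of_absolutelyContinuous {μ : Measure (EuclideanSpace ℝ (Fin d))}
    (hμ : μ ≪ volume) : shannonEntropy μ = (entropyPosPart (lebesgueDensity μ) : EReal) -
      (entropyNegPart (lebesgueDensity μ) : EReal) := by
  rw [shannonEntropy, if_pos hμ]
  rfl

theorem shannonEntropy_withDensity {D : EuclideanSpace ℝ (Fin d) → ENNReal} (hD : Measurable D) :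
    shannonEntropy (volume.withDensity D) = (entropyPosPart (fun x => (D x).toReal) : EReal) -
      (entropyNegPart (fun x => (D x).toReal) : EReal) := by
  rw [shannonEntropy_of_absolutelyContinuous (withDensity_absolutelyContinuous _ _)]
  have h : lebesgueDensity (volume.withDensity D) =ᵐ[volume] fun x => (D x).toReal := by
    filter_upwards [Measure.rnDeriv_withDensity volume hD] with x hx
    rw [lebesgueDensity, hx]
  have hA : entropyPosPart (lebesgueDensity (volume.withDensity D)) =
      entropyPosPart fun x => (D x).toReal :=
    lintegral_congr_ae (h.mono fun x hx => by simp only [hx])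
  have hB : entropyNegPart (lebesgueDensity (volume.withDensity D)) =
      entropyNegPart fun x => (D x).toReal :=
    lintegral_congr_ae (h.mono fun x hx => by simp only [hx])
  rw [hA, hB]

/-- The density of a linear combination of independent random vectors with densities. -/
theorem map_combination_eq_withDensity {Ω : Type*} [MeasurableSpace Ω] {P : Measure Ω}
    [IsProbabilityMeasure P] {η ξ : Ω → EuclideanSpace ℝ (Fin d)} (hη : Measurable η)
    (hξ : Measurable ξ) (hind : IndepFun η ξ P) {c : ℝ} (hc : 0 < c) (s : ℝ)
    (h1 : P.map η ≪ volume) (h2 : P.map ξ ≪ volume) :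
    P.map (fun ω => c • η ω + s • ξ ω) = volume.withDensity (combDensity c s
      (fun x => ENNReal.ofReal (lebesgueDensity (P.map η) x))
      (fun x => ENNReal.ofReal (lebesgueDensity (P.map ξ) x))) := by
  have := Measure.isProbabilityMeasure_map (μ := P) hη.aemeasurable
  have := Measure.isProbabilityMeasure_map (μ := P) hξ.aemeasurable
  have hf := (measurable_lebesgueDensity (P.map η)).ennreal_ofReal
  have hg := (measurable_lebesgueDensity (P.map ξ)).ennreal_ofReal
  rw [← map_withDensity_combination hc s hf hg, ← prod_withDensity hf hg,
    withDensity_lebesgueDensity h1, withDensity_lebesgueDensity h2,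
    ← (indepFun_iff_map_prod_eq_prod_map_map hη.aemeasurable hξ.aemeasurable).1 hind,
    Measure.map_map (by fun_prop) (hη.prodMk hξ)]
  rfl

end Main

theorem mainTheorem8 {Ω : Type*} [MeasurableSpace Ω] (P : Measure Ω) [IsProbabilityMeasure P]
    (d : ℕ) (η ξ : Ω → EuclideanSpace ℝ (Fin d)) (hη : Measurable η) (hξ : Measurable ξ)
    (hind : IndepFun η ξ P) (θ : ℝ) (hθ : θ ∈ Set.Icc 0 (Real.pi / 2)) :
    (P.map η ≪ volume → P.map ξ ≪ volume →
      P.map (fun ω => Real.cos θ • η ω + Real.sin θ • ξ ω) ≪ volume) ∧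
    ((Real.cos θ ^ 2 : ℝ) : EReal) * shannonEntropy (P.map η)
        + ((Real.sin θ ^ 2 : ℝ) : EReal) * shannonEntropy (P.map ξ)
      ≤ shannonEntropy (P.map (fun ω => Real.cos θ • η ω + Real.sin θ • ξ ω)) := by
  have hc0 : 0 ≤ Real.cos θ := Real.cos_nonneg_of_mem_Icc ⟨by linarith [hθ.1, Real.pi_pos], hθ.2⟩
  have hs0 : 0 ≤ Real.sin θ :=
    Real.sin_nonneg_of_mem_Icc ⟨hθ.1, by linarith [hθ.2, Real.pi_pos]⟩
  have hcs := Real.cos_sq_add_sin_sq θ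
  generalize Real.cos θ = c at *
  generalize Real.sin θ = s at *
  -- At the endpoint angles the combination is one of the two vectors, and `0 * S = 0` in `EReal`
  -- even for infinite `S`.
  rcases hc0.eq_or_lt with rfl | hc
  · obtain rfl : s = 1 := by nlinarith
    simp
  rcases hs0.eq_or_lt with rfl | hs
  · obtain rfl : c = 1 := by nlinarith
    exact ⟨fun h1 _ => by simpa using h1, by simp⟩
  have := Measure.isProbabilityMeasure_map (μ := P) hη.aemeasurable
  have := Measure.isProbabilityMeasure_map (μ := P) hξ.aemeasurable
  constructor
  · intro h1 h2
    rw [map_combination_eq_withDensity hη hξ hind hc s h1 h2]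
    exact withDensity_absolutelyContinuous _ _
  -- An entropy `⊥` with positive weight makes the left side `⊥`. Otherwise both laws have densities
  -- with finite negative entropy part.
  by_cases hS1 : shannonEntropy (P.map η) = ⊥
  · rw [hS1, EReal.coe_mul_bot_of_pos (pow_pos hc 2), EReal.bot_add]
    exact bot_le
  by_cases hS2 : shannonEntropy (P.map ξ) = ⊥
  · rw [hS2, EReal.coe_mul_bot_of_pos (pow_pos hs 2), EReal.add_bot]
    exact bot_le
  have key : ∀ μ : Measure (EuclideanSpace ℝ (Fin d)), shannonEntropy μ ≠ ⊥ →
      μ ≪ volume ∧ entropyNegPart (lebesgueDensity μ) ≠ ⊤ := by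
    intro μ hμ
    have hac : μ ≪ volume := by
      by_contra hcon
      exact hμ (if_neg hcon)
    refine ⟨hac, fun htop => hμ ?_⟩
    rw [shannonEntropy_of_absolutelyContinuous hac, htop, EReal.coe_ennreal_top, EReal.sub_top]
  obtain ⟨h1, hB1⟩ := key _ hS1
  obtain ⟨h2, hB2⟩ := key _ hS2
  have hf := measurable_lebesgueDensity (P.map η)
  have hg := measurable_lebesgueDensity (P.map ξ)
  rw [map_combination_eq_withDensity hη hξ hind hc s h1 h2,
    shannonEntropy_withDensity (measurable_combDensity c s hf.ennreal_ofReal hg.ennreal_ofReal),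
    shannonEntropy_of_absolutelyContinuous h1, shannonEntropy_of_absolutelyContinuous h2]
  exact entropy_combDensity_ge hc hs hcs hf hg (fun x => ENNReal.toReal_nonneg)
    (fun x => ENNReal.toReal_nonneg) (lintegral_lebesgueDensity h1) (lintegral_lebesgueDensity h2)
    hB1 hB2 rfl
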